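/- **Conventions.** Let $\mathbb T=\{z_1+i_2z_2: z_1,z_2\in\mathbb C\}$ ($i_2^2=-1$; the imaginary unit of $\mathbb C$ is written $i_1$) be the ring of bicomplex numbers, with idempotents $e_1=\frac{1+i_1i_2}{2}$, $e_2=\frac{1-i_1i_2}{2}$. Every $\zeta=x_0+i_1x_1+i_2x_2+i_1i_2x_3\in\mathbb T$ is uniquely $\zeta=\zeta_1e_1+\zeta_2e_2$ with $\zeta_1=z_1-i_1z_2$, $\zeta_2=z_1+i_1z_2\in\mathbb C$; put $\operatorname{Re}\zeta=x_0$, $\operatorname{Im}_j\zeta=x_3$. Put $\Gamma_2(\zeta)=\Gamma(\zeta_1)e_1+\Gamma(\zeta_2)e_2$, $t^{\zeta}=t^{\zeta_1}e_1+t^{\zeta_2}e_2$ for $t>0$, $(l)_u=l(l+1)\cdots(l+u-1)$, and $$\mathbb E^{l}_{m,n}(\zeta)=\sum_{u=0}^\infty\frac{(l)_u}{u!\,\Gamma_2(mu+n)}\zeta^u .$$ The same formula with complex entries and $\Gamma$ in place of $\Gamma_2$ gives the complex Prabhakar function $E^{l}_{m,n}$. For complex $m,\nu,r,l$ with $\operatorname{Re}m>0$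 and $\operatorname{Re}\nu>0$ let $$(\mathbf E^{l}_{m,\nu,r,0+}g)(t)=\int_0^t (t-y)^{\nu-1}E^{l}_{m,\nu}\big(r(t-y)^m\big)g(y)\,dy ,$$ and for $\operatorname{Re}\nu=0$ let $\mathbf E^{l}_{m,\nu,r,0+}g=\frac{d}{dt}\mathbf E^{l}_{m,\nu+1,r,0+}g$. For complex $n$ with $\operatorname{Re}n>0$ and $k=\lceil\operatorname{Re}n\rceil$ the regularized Prabhakar derivative is ${}^{C}D^{l}_{m,n,r,0+}f=\mathbf E^{-l}_{m,k-n,r,0+}f^{(k)}$. For bicomplex parameters and $f=f_1e_1+f_2e_2$ set $${}^{C}\mathbb D^{l}_{m,n,r,0+}f=\sum_{i=1}^{2}\big({}^{C}D^{l_i}_{m_i,n_i,r_i,0+}f_i\big)e_i .$$ Let $m,n,r,l,A\in\mathbb T$ with $|\operatorname{Im}_j(m)|<\operatorname{Re}(m)$ and $|\operatorname{Im}_j(n)|<\operatorname{Re}(n)$, put $k_i=\lceil\operatorname{Re}(n_i)\rceil$ and $k=k_1e_1+k_2e_2$, and let $\tau_0,\tau_1,\dots\in\mathbb T$ (the component $(\tau_p)_i$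 is used only for $p<k_i$). Let $0<b\le\infty$. Consider on $(0,b)$ the Cauchy problem $${}^{C}\mathbb D^{l}_{m,n,r,0+}f(t)=Af(t),\qquad f^{(p)}(0^+)=\tau_p\quad(p=0,\dots,k-1),$$ where the initial conditions mean $f_i^{(p)}(0^+)=(\tau_p)_i$ for $0\le p<k_i$, $i=1,2$. A solution on $(0,b)$ is a function $f=f_1e_1+f_2e_2$ such that $f_i$ is $k_i-1$ times continuously differentiable on $(0,b)$, $f_i^{(k_i-1)}$ extends to an absolutely continuous function on $[0,c]$ for every real $0<c<b$, the initial conditions hold, and the equation holds for almost every $t\in(0,b)$; if $\operatorname{Re}(n_i)$ is an integer, then $\mathbf E^{-l_i}_{m_i,k_i-n_i+1,r_i,0+}f_i^{(k_i)}$ is also required to be absolutely continuous on each such $[0,c]$. **Theorem (Cauchy problem for the regularized Prabhakar derivative).** For every $t>0$ and every integer $p\ge0$ the series $\sum_{j}A^{j}t^{nj+p}\,\mathbb E^{jl}_{m,nj+p+1}(rt^{m})$ converges. The function $$F(t)=\sum_{p=0}^{k-1}\sum_{j=0}^{\infty}A^{j}\,t^{nj+p}\,\mathbb E^{jl}_{m,\,nj+p+1}(rt^{m})\,\tau_p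 ,\qquad \sum_{p=0}^{k-1}:=e_1\sum_{p=0}^{k_1-1}+e_2\sum_{p=0}^{k_2-1},$$ is a solution of the Cauchy problem on $(0,\infty)$, and it satisfies the equation at every $t>0$. For every $0<b\le\infty$, every solution $f$ on $(0,b)$ satisfies $f(t)=F(t)$ for all $t\in(0,b)$. -/

import Mathlib

open MeasureTheory Filter Topology Set
open scoped Nat

noncomputable section

/-- Bicomplex numbers `z₁ + i₂ z₂` with `z₁, z₂ ∈ ℂ` and `i₂² = -1` (commutative ring);
`re` is `z₁`, `im` is `z₂`, and the imaginary unit of `ℂ` plays the role of `i₁`. -/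
abbrev Bicomplex : Type := QuadraticAlgebra ℂ (-1) 0

namespace Bicomplex

/-- The usual topology, that of `ℂ × ℂ` in the coordinates `(z₁, z₂)`. -/
instance instTopologicalSpace : TopologicalSpace Bicomplex :=
  TopologicalSpace.induced (fun ζ : Bicomplex => ((ζ.re, ζ.im) : ℂ × ℂ)) inferInstance

/-- Real part `x₀` of `x₀ + i₁ x₁ + i₂ x₂ + j x₃`. -/
def rePart (ζ : Bicomplex) : ℝ := ζ.re.re

/-- Coefficient `x₃` of the hyperbolic unit `j = i₁ i₂`. -/
def imJ (ζ : Bicomplex) : ℝ := ζ.im.im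

/-- The idempotent `e₁ = (1 + i₁ i₂) / 2`. -/
def e₁ : Bicomplex := ⟨1 / 2, Complex.I / 2⟩

/-- The idempotent `e₂ = (1 - i₁ i₂) / 2`. -/
def e₂ : Bicomplex := ⟨1 / 2, -Complex.I / 2⟩

/-- First idempotent component `ζ₁ = z₁ - i₁ z₂`. -/
def P₁ (ζ : Bicomplex) : ℂ := ζ.re - Complex.I * ζ.im

/-- Second idempotent component `ζ₂ = z₁ + i₁ z₂`. -/
def P₂ (ζ : Bicomplex) : ℂ := ζ.re + Complex.I * ζ.im

/-- The bicomplex number `a e₁ + b e₂` with idempotent components `a, b ∈ ℂ`. -/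
def ofIdem (a b : ℂ) : Bicomplex := a • e₁ + b • e₂

theorem ofIdem_P (ζ : Bicomplex) : ofIdem (P₁ ζ) (P₂ ζ) = ζ := by
  have hI : Complex.I * Complex.I = -1 := Complex.I_mul_I
  ext
  · simp [ofIdem, P₁, P₂, e₁, e₂]
    ring
  · simp [ofIdem, P₁, P₂, e₁, e₂]
    linear_combination (-ζ.im) * hI

/-- The reciprocal `1 / Γ₂` of the bicomplex Gamma function
`Γ₂(ζ) = Γ(ζ₁) e₁ + Γ(ζ₂) e₂`.  It is entire: Mathlib's `Γ` is `0` at its poles, so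
that `Γ⁻¹` is `0` there, which is the value of `1 / Γ`. -/
def recipGamma (ζ : Bicomplex) : Bicomplex :=
  ofIdem (Complex.Gamma (P₁ ζ))⁻¹ (Complex.Gamma (P₂ ζ))⁻¹

/-- The power `t ^ ζ = t ^ ζ₁ e₁ + t ^ ζ₂ e₂`, for `t > 0`. -/
def rpow (t : ℝ) (ζ : Bicomplex) : Bicomplex := ofIdem ((t : ℂ) ^ P₁ ζ) ((t : ℂ) ^ P₂ ζ)

/-- Bicomplex Prabhakar function
`𝔼^l_{m,n}(ζ) = ∑ᵤ (l)ᵤ / (u! Γ₂(m u + n)) ζ ^ u`. -/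
def prabhakar (m n l ζ : Bicomplex) : Bicomplex :=
  ∑' u : ℕ, ((u ! : ℂ)⁻¹) •
    ((ascPochhammer Bicomplex u).eval l * recipGamma (m * (u : Bicomplex) + n) * ζ ^ u)

end Bicomplex

namespace Prabhakar

/-- Complex Prabhakar function `E^l_{m,n}(z) = ∑ᵤ (l)ᵤ / (u! Γ(m u + n)) z ^ u`. -/
def fn (m n l z : ℂ) : ℂ :=
  ∑' u : ℕ, (ascPochhammer ℂ u).eval l / ((u ! : ℂ) * Complex.Gamma (m * (u : ℂ) + n)) * z ^ u

/-- Prabhakar kernel `e^l_{m,n,r}(t) = t^{n-1} E^l_{m,n}(r t^m)`. -/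
def kernel (m n r l : ℂ) (t : ℝ) : ℂ := (t : ℂ) ^ (n - 1) * fn m n l (r * (t : ℂ) ^ m)

/-- The convolution `∫₀ᵗ (t - y)^{n-1} E^l_{m,n}(r (t - y)^m) g(y) dy`. -/
def conv (m n r l : ℂ) (g : ℝ → ℂ) (t : ℝ) : ℂ :=
  ∫ y in (0 : ℝ)..t, kernel m n r l (t - y) * g y

/-- Prabhakar integral `E^l_{m,n,r,0+} g`.  For `Re n > 0` it is the convolution with the kernel.
For `Re n = 0`, where the kernel is not integrable, it is the usual extension
`d/dt E^l_{m,n+1,r,0+} g` (the identity operator when `n = 0` and `l = 0`). -/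
def integral (m n r l : ℂ) (g : ℝ → ℂ) (t : ℝ) : ℂ :=
  if 0 < n.re then conv m n r l g t else deriv (conv m (n + 1) r l g) t

/-- The order `⌈Re n⌉` of the integer derivative. -/
def order (n : ℂ) : ℕ := ⌈n.re⌉₊

/-- Regularized Prabhakar derivative `E^{-l}_{m,k-n,r,0+} (d^k/dt^k) f`, `k = ⌈Re n⌉`. -/
def regDeriv (m n r l : ℂ) (f : ℝ → ℂ) (t : ℝ) : ℂ :=
  integral m ((order n : ℂ) - n) r (-l) (iteratedDeriv (order n) f) t

/-- `g` has `k - 1` continuous derivatives on `(0, b)`, and the `(k-1)`-st one extends to an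
absolutely continuous function on each `[0, c]` with `0 < c < b` (for `k ≥ 1`, `0 < b ≤ ∞`). -/
def MemAC (k : ℕ) (b : EReal) (g : ℝ → ℂ) : Prop :=
  ContDiffOn ℝ ((k - 1 : ℕ) : ℕ∞) g {t : ℝ | 0 < t ∧ (t : EReal) < b} ∧
  ∀ c : ℝ, 0 < c → (c : EReal) < b →
    ∃ h : ℝ → ℂ, AbsolutelyContinuousOnInterval h 0 c ∧
      EqOn (iteratedDeriv (k - 1) g) h (Ioo 0 c)

/-- The functions to which the regularized Prabhakar derivative is applied on `(0, b)`: those in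
`AC^k`, `k = ⌈Re n⌉`.  If `Re n` is an integer (`Re (k - n) = 0`), the function
`E^{-l}_{m,k-n+1,r,0+} f^{(k)}` that is then differentiated has to be absolutely continuous. -/
def MemDomain (m n r l : ℂ) (b : EReal) (f : ℝ → ℂ) : Prop :=
  MemAC (order n) b f ∧
  (((order n : ℂ) - n).re = 0 → ∀ c : ℝ, 0 < c → (c : EReal) < b →
    AbsolutelyContinuousOnInterval
      (conv m ((order n : ℂ) - n + 1) r (-l) (iteratedDeriv (order n) f)) 0 c)

/-- The initial conditions `f^{(p)}(0+) = τ_p` for `0 ≤ p < k`. -/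
def HasInitialValues (k : ℕ) (τ : ℕ → ℂ) (f : ℝ → ℂ) : Prop :=
  ∀ p < k, Tendsto (iteratedDeriv p f) (𝓝[>] 0) (𝓝 (τ p))

end Prabhakar

namespace Bicomplex

/-- Bicomplex regularized Prabhakar derivative `^C𝔻^l_{m,n,r,0+} f`.  Its integer order
`k = ⌈Re n₁⌉ e₁ + ⌈Re n₂⌉ e₂` is a hyperbolic number, so that `d^k/dt^k` and the integral act
on the two idempotent components of `f`. -/
def regDeriv (m n r l : Bicomplex) (f : ℝ → Bicomplex) (t : ℝ) : Bicomplex :=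
  ofIdem
    (Prabhakar.regDeriv (P₁ m) (P₁ n) (P₁ r) (P₁ l) (fun s => P₁ (f s)) t)
    (Prabhakar.regDeriv (P₂ m) (P₂ n) (P₂ r) (P₂ l) (fun s => P₂ (f s)) t)

/-- `f` solves, on `(0, b)` with `0 < b ≤ ∞`, the Cauchy problem
`^C𝔻^l_{m,n,r,0+} f = A f`, `f^{(p)}(0+) = τ_p` for `p = 0, …, k - 1`, where
`k = ⌈Re n₁⌉ e₁ + ⌈Re n₂⌉ e₂`: the `i`-th idempotent component has the initial values
with `p < ⌈Re nᵢ⌉`. -/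
structure IsCauchySolution (m n r l A : Bicomplex) (τ : ℕ → Bicomplex) (b : EReal)
    (f : ℝ → Bicomplex) : Prop where
  mem₁ : Prabhakar.MemDomain (P₁ m) (P₁ n) (P₁ r) (P₁ l) b (fun t => P₁ (f t))
  mem₂ : Prabhakar.MemDomain (P₂ m) (P₂ n) (P₂ r) (P₂ l) b (fun t => P₂ (f t))
  init₁ : Prabhakar.HasInitialValues (Prabhakar.order (P₁ n)) (fun p => P₁ (τ p))
    (fun t => P₁ (f t))
  init₂ : Prabhakar.HasInitialValues (Prabhakar.order (P₂ n)) (fun p => P₂ (τ p))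
    (fun t => P₂ (f t))
  eqn : ∀ᵐ t : ℝ, 0 < t → (t : EReal) < b → regDeriv m n r l f t = A * f t

/-- The term `A^j t^{nj+p} 𝔼^{jl}_{m,nj+p+1}(r t^m)`. -/
def cauchyTerm (m n r l A : Bicomplex) (p j : ℕ) (t : ℝ) : Bicomplex :=
  A ^ j * rpow t (n * (j : Bicomplex) + (p : Bicomplex)) *
    prabhakar m (n * (j : Bicomplex) + (p : Bicomplex) + 1) ((j : Bicomplex) * l) (r * rpow t m)

/-- The double series `∑_{p=0}^{k-1} ∑_{j=0}^∞ A^j t^{nj+p} 𝔼^{jl}_{m,nj+p+1}(r t^m) τ_p`, where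
for the hyperbolic integer `k = k₁ e₁ + k₂ e₂` the sum `∑_{p=0}^{k-1}` means
`e₁ ∑_{p=0}^{k₁-1} + e₂ ∑_{p=0}^{k₂-1}`. -/
def cauchySeries (m n r l A : Bicomplex) (τ : ℕ → Bicomplex) (t : ℝ) : Bicomplex :=
  e₁ * ∑ p ∈ Finset.range (Prabhakar.order (P₁ n)), (∑' j : ℕ, cauchyTerm m n r l A p j t) * τ p +
  e₂ * ∑ p ∈ Finset.range (Prabhakar.order (P₂ n)), (∑' j : ℕ, cauchyTerm m n r l A p j t) * τ p

end Bicomplex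

end

/-!
In idempotent components the bicomplex problem is a pair of independent complex problems: `P₁` and
`P₂` are ring homomorphisms that jointly determine a bicomplex number and its topology, and the
hypotheses on `m` and `n` say that both components of `m` and of `n` have positive real part.

*The scalar series.*  Every function in sight is a series of normalised powers
`phi s t = t ^ (s - 1) / Γ(s)`, which satisfy `phi s * phi s' = phi (s + s')` for the half-line
convolution (Beta integral, `lconv_phi_phi`) and `(phi (s + 1))' = phi s`.  With the Chu–Vandermonde
identity this gives the semigroup law `e^l_q * e^{l'}_{q'} = e^{l + l'}_{q + q'}` of the Prabhakar
kernels (`lconv_kernel_kernel`), and then the action of a kernel on the series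
`∑ⱼ A^j e^{l₀ + jl}_{q + jn}` (`lconv_kernel_kernelSeries`).  Convergence rests on
`exists_norm_phi_le`: the ratio `Γ(Re z) / |Γ(z)|` is submultiplicative because
`|B(z, w)| ≤ B(Re z, Re w)`, so along `q + jn + um` it grows at most geometrically, whereas the real
Gamma function outgrows every exponential.

*Existence.*  Differentiating the series `k` times lowers the orders by `k` and kills the terms with
`j = 0`; convolving with `e^{-l}_{k - n}` then shifts `j` by one, which produces the factor `A`
(`regDeriv_sol`).  If `Re n` is an integer, the convolution is made with `e^{-l}_{k - n + 1}` and
followed by a derivative.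

*Uniqueness.*  Integrating the equation once removes the distinction between the two cases.
Convolution with `e^l_n` and integration by parts turn it into a Volterra equation for the primitive
of `f` (`IsScalarSolution.volterra`).  The difference `D` of two solutions has primitive
`A^j e^{jl}_{jn + 1} * D` for every `j`, and these tend to `0` because the kernels are terms of a
convergent series (`integral_eq_zero_of_volterra`).  Since `D` is continuous, `D = 0`.
-/

namespace Prabhakar

/-! ### Power kernels and the Beta integral -/

/-- The normalised power `t ^ (s - 1) / Γ(s)`; since `(Γ s)⁻¹` is the entire function `1 / Γ`, it
vanishes for `s = 0, -1, -2, …`. -/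
noncomputable def phi (s : ℂ) (t : ℝ) : ℂ := (t : ℂ) ^ (s - 1) * (Complex.Gamma s)⁻¹

theorem intervalIntegrable_beta {α β : ℝ} (hα : 0 < α) (hβ : 0 < β) {t : ℝ} (ht : 0 < t) :
    IntervalIntegrable (fun y : ℝ => (t - y) ^ (α - 1) * y ^ (β - 1)) volume 0 t := by
  -- Only the singularity at `0` matters on `[0, t / 2]`; the other half follows by reflection.
  have key : ∀ {a b : ℝ}, 0 < b →
      IntervalIntegrable (fun y : ℝ => (t - y) ^ (a - 1) * y ^ (b - 1)) volume 0 (t / 2) := by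
    intro a b hb
    refine IntervalIntegrable.continuousOn_mul
      (intervalIntegral.intervalIntegrable_rpow' (by linarith)) ?_
    intro y hy
    rw [uIcc_of_le (by positivity)] at hy
    refine ContinuousAt.continuousWithinAt ?_
    refine ContinuousAt.rpow_const (by fun_prop) (Or.inl ?_)
    have := hy.2
    linarith
  refine (key hβ).trans ?_
  have h := ((key (a := β) hα).comp_sub_left t).symm
  rw [sub_zero, show t - t / 2 = t / 2 by ring] at h
  simpa [mul_comm] using h

theorem integral_beta {α β : ℝ} (hα : 0 < α) (hβ : 0 < β) {t : ℝ} (ht : 0 < t) :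
    ∫ y in (0 : ℝ)..t, (t - y) ^ (α - 1) * y ^ (β - 1) =
      t ^ (α + β - 1) * (Real.Gamma α * Real.Gamma β / Real.Gamma (α + β)) := by
  have h := Complex.betaIntegral_scaled (β : ℂ) (α : ℂ) ht
  have hG := Complex.Gamma_mul_Gamma_eq_betaIntegral (s := (β : ℂ)) (t := (α : ℂ))
    (by simpa using hβ) (by simpa using hα)
  have hne : Complex.Gamma ((β : ℂ) + α) ≠ 0 :=
    Complex.Gamma_ne_zero_of_re_pos (by simp; linarith)
  have hB : Complex.betaIntegral β α =
      ((Real.Gamma α * Real.Gamma β / Real.Gamma (α + β) : ℝ) : ℂ) := by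
    have : ((Real.Gamma (α + β) : ℝ) : ℂ) = Complex.Gamma ((β : ℂ) + α) := by
      rw [← Complex.Gamma_ofReal]; push_cast; rw [add_comm]
    push_cast
    rw [this, eq_div_iff hne, ← Complex.Gamma_ofReal, ← Complex.Gamma_ofReal]
    linear_combination -hG
  rw [hB] at h
  have h2 : ((∫ y in (0 : ℝ)..t, (t - y) ^ (α - 1) * y ^ (β - 1) : ℝ) : ℂ) =
      ∫ y in (0 : ℝ)..t, (y : ℂ) ^ ((β : ℂ) - 1) * ((t : ℂ) - y) ^ ((α : ℂ) - 1) := by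
    rw [← intervalIntegral.integral_ofReal]
    refine intervalIntegral.integral_congr fun y hy => ?_
    rw [uIcc_of_le ht.le] at hy
    push_cast [Complex.ofReal_cpow hy.1, Complex.ofReal_cpow (sub_nonneg.2 hy.2)]
    ring
  rw [h, add_comm (β : ℂ)] at h2
  apply Complex.ofReal_injective
  rw [h2]
  push_cast [Complex.ofReal_cpow ht.le]
  ring

theorem norm_ofReal_cpow {t : ℝ} (ht : 0 < t) (s : ℂ) : ‖(t : ℂ) ^ s‖ = t ^ s.re := by
  rw [Complex.norm_cpow_eq_rpow_re_of_pos ht]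

theorem norm_betaIntegral_le {z w : ℂ} (hz : 0 < z.re) (hw : 0 < w.re) :
    ‖Complex.betaIntegral z w‖ ≤
      Real.Gamma z.re * Real.Gamma w.re / Real.Gamma (z.re + w.re) := by
  have h := integral_beta hw hz one_pos
  rw [Real.one_rpow, one_mul] at h
  rw [mul_comm (Real.Gamma z.re), add_comm z.re, ← h, Complex.betaIntegral,
    intervalIntegral.integral_of_le zero_le_one, intervalIntegral.integral_of_le zero_le_one]
  refine (norm_integral_le_integral_norm _).trans_eq ?_
  rw [integral_Ioc_eq_integral_Ioo, integral_Ioc_eq_integral_Ioo]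
  refine setIntegral_congr_fun measurableSet_Ioo fun y hy => ?_
  have h1 : (1 : ℂ) - (y : ℂ) = ((1 - y : ℝ) : ℂ) := by push_cast; ring
  rw [norm_mul, h1, norm_ofReal_cpow hy.1, norm_ofReal_cpow (sub_pos.2 hy.2), mul_comm]
  simp

/-! ### Decay of the reciprocal Gamma function in a sector -/

/-- The ratio `Γ(Re z) / |Γ(z)|`, which measures how far `|Γ(z)|` drops below its value at
`Re z`. -/
noncomputable def gammaRatio (z : ℂ) : ℝ := Real.Gamma z.re * ‖(Complex.Gamma z)⁻¹‖

theorem gammaRatio_nonneg {z : ℂ} (hz : 0 < z.re) : 0 ≤ gammaRatio z :=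
  mul_nonneg (Real.Gamma_pos_of_pos hz).le (norm_nonneg _)

/-- Submultiplicativity, by comparing `B(z, w)` with `B(Re z, Re w)`.  It controls `|Γ|` along
an arithmetic progression without Stirling's formula. -/
theorem gammaRatio_add_le {z w : ℂ} (hz : 0 < z.re) (hw : 0 < w.re) :
    gammaRatio (z + w) ≤ gammaRatio z * gammaRatio w := by
  have hG := Complex.Gamma_mul_Gamma_eq_betaIntegral hz hw
  have hz0 := norm_pos_iff.2 (Complex.Gamma_ne_zero_of_re_pos hz)
  have hw0 := norm_pos_iff.2 (Complex.Gamma_ne_zero_of_re_pos hw)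
  have hzw0 : 0 < ‖Complex.Gamma (z + w)‖ :=
    norm_pos_iff.2 (Complex.Gamma_ne_zero_of_re_pos (by rw [Complex.add_re]; linarith))
  have hn := congrArg norm hG
  rw [norm_mul, norm_mul] at hn
  have hB := norm_betaIntegral_le hz hw
  have hR : 0 < Real.Gamma (z.re + w.re) := Real.Gamma_pos_of_pos (by linarith)
  rw [le_div_iff₀ hR] at hB
  unfold gammaRatio
  rw [norm_inv, norm_inv, norm_inv, Complex.add_re, ← div_eq_mul_inv, ← div_eq_mul_inv,
    ← div_eq_mul_inv, div_mul_div_comm, div_le_div_iff₀ hzw0 (mul_pos hz0 hw0), hn]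
  calc Real.Gamma (z.re + w.re) * (‖Complex.Gamma (z + w)‖ * ‖z.betaIntegral w‖)
      = ‖z.betaIntegral w‖ * Real.Gamma (z.re + w.re) * ‖Complex.Gamma (z + w)‖ := by ring
    _ ≤ _ := by gcongr

theorem gammaRatio_add_natCast_mul_le {q m : ℂ} (hq : 0 < q.re) (hm : 0 < m.re) (u : ℕ) :
    gammaRatio (q + u * m) ≤ gammaRatio q * gammaRatio m ^ u := by
  induction u with
  | zero => simp
  | succ u ih =>
    have h1 : q + ((u + 1 : ℕ) : ℂ) * m = (q + u * m) + m := by push_cast; ring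
    have h2 : 0 < (q + u * m).re := by
      simp only [Complex.add_re, Complex.mul_re, Complex.natCast_re, Complex.natCast_im]
      have : 0 ≤ (u : ℝ) * m.re := by positivity
      linarith
    rw [h1, pow_succ, ← mul_assoc]
    exact (gammaRatio_add_le h2 hm).trans
      (mul_le_mul_of_nonneg_right ih (gammaRatio_nonneg hm))

/-- The Gamma function outgrows every exponential: restrict the Euler integral to
`[M, M + 1]`. -/
theorem rpow_le_mul_Gamma {M x : ℝ} (hM : 0 < M) (hx : 0 < x) :
    M ^ x ≤ (M + 1) * Real.exp (M + 1) * Real.Gamma x := by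
  have hint := Real.GammaIntegral_convergent hx
  have h1 : ∫ _ in Ioc M (M + 1), Real.exp (-(M + 1)) * (M ^ x / (M + 1)) ≤
      ∫ s in Ioc M (M + 1), Real.exp (-s) * s ^ (x - 1) := by
    refine setIntegral_mono_on (integrableOn_const (by simp)) (hint.mono_set fun s hs => ?_)
      measurableSet_Ioc fun s hs => ?_
    · exact hM.trans hs.1
    · have hs0 : 0 < s := hM.trans hs.1
      have h3 := hs.1
      have h4 := hs.2
      rw [Real.rpow_sub_one hs0.ne']
      gcongr
  have h2 : ∫ s in Ioc M (M + 1), Real.exp (-s) * s ^ (x - 1) ≤ Real.Gamma x := by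
    rw [Real.Gamma_eq_integral hx]
    refine setIntegral_mono_set hint ?_ ?_
    · refine (ae_restrict_mem measurableSet_Ioi).mono fun s hs => ?_
      have : (0 : ℝ) < s := hs
      simp only [Pi.zero_apply]
      positivity
    · have hsub : Ioc M (M + 1) ⊆ Ioi 0 := fun s hs => hM.trans hs.1
      exact hsub.eventuallyLE
  have h3 := h1.trans h2
  simp only [integral_const, smul_eq_mul, measureReal_restrict_apply_univ, Real.volume_real_Ioc,
    add_sub_cancel_left, Real.exp_neg] at h3
  rw [max_eq_left zero_le_one, one_mul] at h3
  have he := Real.exp_pos (M + 1)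
  rw [← div_eq_inv_mul, div_div, div_le_iff₀ (by positivity)] at h3
  linarith

/-- Geometric bound, with ratios as small as desired, for the normalised powers whose exponent
runs through a two-parameter arithmetic progression. -/
theorem exists_norm_phi_le {m n q : ℂ} (hm : 0 < m.re) (hn : 0 < n.re) (hq : 0 < q.re)
    (T : ℝ) {ε : ℝ} (hε : 0 < ε) :
    ∃ C, 0 ≤ C ∧ ∀ j u : ℕ, ∀ t ∈ Ioc 0 T,
      ‖phi (q + j * n + u * m) t‖ ≤ C * ε ^ j * ε ^ u * t ^ (q.re - 1) := by
  rcases le_or_gt T 0 with hT | hT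
  · exact ⟨0, le_rfl, fun j u t ht => absurd (ht.1.trans_le ht.2) hT.not_gt⟩
  -- Choose the base `M` of the exponential lower bound for `Γ` so large that it beats both ratios.
  have hlim : ∀ {a : ℝ} (R : ℝ), 0 < a → ∀ᶠ M : ℝ in atTop, R * (T ^ a * M ^ (-a)) < ε := by
    intro a R ha
    have h := ((tendsto_rpow_neg_atTop ha).const_mul (T ^ a)).const_mul R
    simp only [mul_zero] at h
    exact h.eventually_lt_const hε
  obtain ⟨M, hM, hMm, hMn⟩ := ((eventually_gt_atTop 0).and ((hlim (gammaRatio m) hm).and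
    (hlim (gammaRatio n) hn))).exists
  refine ⟨gammaRatio q * ((M + 1) * Real.exp (M + 1)) * M ^ (-q.re),
    mul_nonneg (mul_nonneg (gammaRatio_nonneg hq) (by positivity)) (by positivity), ?_⟩
  intro j u t ht
  have h2 : 0 < (q + j * n).re := by
    simp only [Complex.add_re, Complex.mul_re, Complex.natCast_re, Complex.natCast_im]
    have : 0 ≤ (j : ℝ) * n.re := by positivity
    linarith
  have hre : (q + j * n + u * m).re = q.re + j * n.re + u * m.re := by simp
  have h3 : 0 < (q + j * n + u * m).re := by
    have h4 : (q + j * n).re = q.re + j * n.re := by simp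
    have : 0 ≤ (u : ℝ) * m.re := by positivity
    linarith
  set s := q + j * n + u * m with hs
  have hρ : gammaRatio s ≤ gammaRatio q * gammaRatio n ^ j * gammaRatio m ^ u :=
    (gammaRatio_add_natCast_mul_le h2 hm u).trans (mul_le_mul_of_nonneg_right
      (gammaRatio_add_natCast_mul_le hq hn j) (pow_nonneg (gammaRatio_nonneg hm) _))
  have hG := rpow_le_mul_Gamma hM h3
  have hGpos := Real.Gamma_pos_of_pos h3
  set K := (M + 1) * Real.exp (M + 1) with hK
  have hKpos : 0 < K := by positivity
  have hinv : ‖(Complex.Gamma s)⁻¹‖ ≤ gammaRatio s * (K * M ^ (-s.re)) := by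
    unfold gammaRatio
    have : 1 ≤ Real.Gamma s.re * (K * M ^ (-s.re)) := by
      rw [Real.rpow_neg hM.le, ← mul_assoc, ← div_eq_mul_inv, one_le_div (by positivity)]
      linarith
    nlinarith [norm_nonneg (Complex.Gamma s)⁻¹]
  have hρm := gammaRatio_nonneg hm
  have hρn := gammaRatio_nonneg hn
  have hρq := gammaRatio_nonneg hq
  have hsplit : ∀ {x : ℝ}, 0 < x → x ^ (s.re) = x ^ q.re * (x ^ n.re) ^ j * (x ^ m.re) ^ u := by
    intro x hx
    rw [hre, Real.rpow_add hx, Real.rpow_add hx, mul_comm (j : ℝ), mul_comm (u : ℝ),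
      Real.rpow_mul hx.le, Real.rpow_mul hx.le, Real.rpow_natCast, Real.rpow_natCast]
  have ht0 : 0 < t := ht.1
  rw [phi, norm_mul, norm_ofReal_cpow ht0, Complex.sub_re, Complex.one_re,
    Real.rpow_sub_one ht0.ne', Real.rpow_sub_one ht0.ne']
  calc t ^ s.re / t * ‖(Complex.Gamma s)⁻¹‖
      ≤ t ^ s.re / t * ((gammaRatio q * gammaRatio n ^ j * gammaRatio m ^ u) *
          (K * M ^ (-s.re))) := by
        gcongr
        exact hinv.trans (by gcongr)
    _ = gammaRatio q * K * M ^ (-q.re) * (gammaRatio n * (t ^ n.re * M ^ (-n.re))) ^ j *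
          (gammaRatio m * (t ^ m.re * M ^ (-m.re))) ^ u * (t ^ q.re / t) := by
        rw [hsplit ht0, Real.rpow_neg hM.le, Real.rpow_neg hM.le, Real.rpow_neg hM.le,
          Real.rpow_neg hM.le, hsplit hM]
        simp only [mul_pow, inv_pow, mul_inv]
        ring
    _ ≤ gammaRatio q * K * M ^ (-q.re) * ε ^ j * ε ^ u * (t ^ q.re / t) := by
        have h5 : gammaRatio n * (t ^ n.re * M ^ (-n.re)) ≤ ε := by
          refine le_trans ?_ hMn.le
          gcongr
          exact ht.2
        have h6 : gammaRatio m * (t ^ m.re * M ^ (-m.re)) ≤ ε := by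
          refine le_trans ?_ hMm.le
          gcongr
          exact ht.2
        gcongr

/-! ### Pochhammer coefficients -/

/-- The coefficient `(l)ᵤ / u!` of the Prabhakar series. -/
noncomputable def coef (l : ℂ) (u : ℕ) : ℂ := (ascPochhammer ℂ u).eval l / (u ! : ℂ)

theorem coef_eq_multichoose (l : ℂ) (u : ℕ) : coef l u = Ring.multichoose l u := by
  have h := Ring.factorial_nsmul_multichoose_eq_ascPochhammer l u
  rw [Polynomial.ascPochhammer_smeval_eq_eval, nsmul_eq_mul] at h
  rw [coef, ← h, mul_div_cancel_left₀ _ (by exact_mod_cast Nat.factorial_ne_zero u)]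

/-- The Chu–Vandermonde identity for rising factorials. -/
theorem sum_antidiagonal_coef (a b : ℂ) (w : ℕ) :
    ∑ x ∈ Finset.HasAntidiagonal.antidiagonal w, coef a x.1 * coef b x.2 = coef (a + b) w := by
  have h := Ring.add_choose_eq (r := -a) (s := -b) w (Commute.all _ _)
  rw [← neg_add] at h
  simp only [Ring.choose_neg', Units.smul_def, zsmul_eq_mul] at h
  have hsq : ∀ w : ℕ, (((Int.negOnePow (w : ℤ) : ℤˣ) : ℤ) : ℂ) = (-1) ^ w := by
    intro w
    rw [Int.negOnePow_def, zpow_natCast]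
    push_cast
    rfl
  simp only [hsq, ← coef_eq_multichoose] at h
  have h1 : ((-1 : ℂ) ^ w) * (-1) ^ w = 1 := by rw [← mul_pow]; simp
  calc _ = (-1) ^ w * ∑ x ∈ Finset.HasAntidiagonal.antidiagonal w,
        (-1) ^ x.1 * coef a x.1 * ((-1) ^ x.2 * coef b x.2) := by
        rw [Finset.mul_sum]
        refine Finset.sum_congr rfl fun x hx => ?_
        have h2 : (-1 : ℂ) ^ w = (-1) ^ x.1 * (-1) ^ x.2 := by
          rw [← pow_add, Finset.HasAntidiagonal.mem_antidiagonal.1 hx]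
        rw [h2] at h1 ⊢
        linear_combination (-(coef a x.1 * coef b x.2)) * h1
    _ = _ := by rw [← h, ← mul_assoc, h1, one_mul]

theorem coef_zero_left (u : ℕ) : coef 0 u = if u = 0 then 1 else 0 := by
  cases u with
  | zero => simp [coef]
  | succ u => simp [coef, ascPochhammer_succ_left]

theorem norm_coef_le {l : ℂ} {N : ℕ} (hN : ‖l‖ ≤ N) (u : ℕ) : ‖coef l u‖ ≤ 2 ^ (N + u) := by
  have h1 : ‖(ascPochhammer ℂ u).eval l‖ ≤ N.ascFactorial u := by
    induction u with
    | zero => simp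
    | succ u ih =>
      rw [ascPochhammer_succ_eval, norm_mul, Nat.ascFactorial_succ, mul_comm]
      push_cast
      refine mul_le_mul ((norm_add_le _ _).trans ?_) ih (norm_nonneg _) (by positivity)
      simpa using hN
  rw [coef, norm_div, Complex.norm_natCast, div_le_iff₀ (by positivity)]
  refine h1.trans ?_
  rw [Nat.ascFactorial_eq_factorial_mul_choose']
  push_cast
  rw [mul_comm]
  gcongr
  have h3 : (N + u - 1).choose u ≤ 2 ^ (N + u) :=
    (Nat.choose_le_two_pow _ _).trans (Nat.pow_le_pow_right (by norm_num) (Nat.sub_le _ _))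
  exact_mod_cast h3

/-! ### Convolution on the half-line -/

/-- The convolution `∫₀ᵗ a(t - y) g(y) dy` on the half-line. -/
noncomputable def lconv (a g : ℝ → ℂ) (t : ℝ) : ℂ := ∫ y in (0 : ℝ)..t, a (t - y) * g y

/-- `a` is continuous on `(0, ∞)` and `a(t) = O(t ^ (α - 1))` on each bounded interval `(0, T]`. -/
structure PowerBound (α : ℝ) (a : ℝ → ℂ) : Prop where
  cont : ContinuousOn a (Ioi 0)
  bound : ∀ T : ℝ, ∃ C, 0 ≤ C ∧ ∀ t ∈ Ioc 0 T, ‖a t‖ ≤ C * t ^ (α - 1)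

@[simp] theorem lconv_zero_right (a g : ℝ → ℂ) : lconv a g 0 = 0 := by simp [lconv]

theorem lconv_eq_setIntegral (a g : ℝ → ℂ) {t : ℝ} (ht : 0 ≤ t) :
    lconv a g t = ∫ y in Ioo 0 t, a (t - y) * g y := by
  rw [lconv, intervalIntegral.integral_of_le ht, integral_Ioc_eq_integral_Ioo]

theorem lconv_congr {a a' g g' : ℝ → ℂ} {t : ℝ} (ht : 0 ≤ t) (ha : EqOn a a' (Ioo 0 t))
    (hg : EqOn g g' (Ioo 0 t)) : lconv a g t = lconv a' g' t := by
  rw [lconv_eq_setIntegral _ _ ht, lconv_eq_setIntegral _ _ ht]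
  refine setIntegral_congr_fun measurableSet_Ioo fun y hy => ?_
  rw [hg hy, ha ⟨sub_pos.2 hy.2, by linarith [hy.1]⟩]

theorem lconv_comm (a g : ℝ → ℂ) (t : ℝ) : lconv a g t = lconv g a t := by
  have h := intervalIntegral.integral_comp_sub_left (a := 0) (b := t)
    (fun y => a y * g (t - y)) t
  simp only [sub_sub_cancel, sub_zero, sub_self] at h
  rw [lconv, h, lconv]
  exact intervalIntegral.integral_congr fun y _ => mul_comm _ _

theorem lconv_const_mul_right (c : ℂ) (a g : ℝ → ℂ) (t : ℝ) :
    lconv a (fun y => c * g y) t = c * lconv a g t := by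
  simp only [lconv, ← intervalIntegral.integral_const_mul]
  exact intervalIntegral.integral_congr fun y _ => by ring

theorem lconv_const_mul_left (c : ℂ) (a g : ℝ → ℂ) (t : ℝ) :
    lconv (fun y => c * a y) g t = c * lconv a g t := by
  simp only [lconv, ← intervalIntegral.integral_const_mul]
  exact intervalIntegral.integral_congr fun y _ => by ring

namespace PowerBound

variable {α β : ℝ} {a b : ℝ → ℂ}

theorem intervalIntegrable (ha : PowerBound α a) (hα : 0 < α) {t : ℝ} (ht : 0 ≤ t) :
    IntervalIntegrable a volume 0 t := by
  obtain ⟨C, hC, h⟩ := ha.bound t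
  have hi : IntervalIntegrable (fun y : ℝ => C * y ^ (α - 1)) volume 0 t :=
    (intervalIntegral.intervalIntegrable_rpow' (by linarith)).const_mul C
  refine hi.mono_fun' ?_ ?_
  · rw [uIoc_of_le ht]
    exact (ha.cont.mono fun y hy => hy.1).aestronglyMeasurable measurableSet_Ioc
  · rw [uIoc_of_le ht]
    exact (ae_restrict_mem measurableSet_Ioc).mono fun y hy => h y hy

theorem continuousOn_comp_sub (ha : PowerBound α a) (t : ℝ) :
    ContinuousOn (fun y => a (t - y)) (Ioo 0 t) :=
  ha.cont.comp (by fun_prop) fun y hy => sub_pos.2 hy.2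

theorem intervalIntegrable_mul (ha : PowerBound α a) (hα : 0 < α) (hb : PowerBound β b)
    (hβ : 0 < β) {t : ℝ} (ht : 0 ≤ t) :
    IntervalIntegrable (fun y => a (t - y) * b y) volume 0 t := by
  rcases ht.eq_or_lt with rfl | ht
  · exact IntervalIntegrable.refl
  obtain ⟨C, hC, h⟩ := ha.bound t
  obtain ⟨D, hD, h'⟩ := hb.bound t
  have hi : IntervalIntegrable (fun y : ℝ => C * D * ((t - y) ^ (α - 1) * y ^ (β - 1)))
      volume 0 t := (intervalIntegrable_beta hα hβ ht).const_mul _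
  rw [intervalIntegrable_iff_integrableOn_Ioo_of_le ht.le] at hi ⊢
  refine Integrable.mono' hi ?_ ?_
  · exact ((ha.continuousOn_comp_sub t).mul (hb.cont.mono fun y hy => hy.1)).aestronglyMeasurable
      measurableSet_Ioo
  · refine (ae_restrict_mem measurableSet_Ioo).mono fun y hy => ?_
    rw [norm_mul]
    have h1 := h (t - y) ⟨sub_pos.2 hy.2, by linarith [hy.1]⟩
    have h2 := h' y ⟨hy.1, hy.2.le⟩
    calc _ ≤ (C * (t - y) ^ (α - 1)) * (D * y ^ (β - 1)) :=
          mul_le_mul h1 h2 (norm_nonneg _) ((norm_nonneg _).trans h1)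
      _ = _ := by ring

theorem const_mul (ha : PowerBound α a) (c : ℂ) : PowerBound α (fun t => c * a t) := by
  refine ⟨continuousOn_const.mul ha.cont, fun T => ?_⟩
  obtain ⟨C, hC, h⟩ := ha.bound T
  refine ⟨‖c‖ * C, by positivity, fun t ht => ?_⟩
  rw [norm_mul, mul_assoc]
  exact mul_le_mul_of_nonneg_left (h t ht) (norm_nonneg _)

/-- Convolution with a power-bounded kernel commutes with a series that is dominated by a
multiple of an integrable power. -/
theorem hasSum_lconv (ha : PowerBound α a) (hα : 0 < α) (hβ : 0 < β) {b : ℕ → ℝ → ℂ} {T : ℝ}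
    {B : ℕ → ℝ} (hB : Summable B) (hcont : ∀ i, ContinuousOn (b i) (Ioi 0))
    (hb : ∀ i, ∀ t ∈ Ioc 0 T, ‖b i t‖ ≤ B i * t ^ (β - 1)) {t : ℝ} (ht : t ∈ Ioc 0 T) :
    HasSum (fun i => lconv a (b i) t) (lconv a (fun s => ∑' i, b i s) t) := by
  obtain ⟨C, hC, h⟩ := ha.bound t
  have hmem : ∀ᵐ y : ℝ, y ∈ uIoc 0 t → y ∈ Ioo 0 t := by
    have : ∀ᵐ y : ℝ, y ≠ t := by simp [ae_iff]
    filter_upwards [this] with y hy hm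
    rw [uIoc_of_le ht.1.le] at hm
    exact ⟨hm.1, lt_of_le_of_ne hm.2 hy⟩
  refine intervalIntegral.hasSum_integral_of_dominated_convergence
    (fun i y => C * (t - y) ^ (α - 1) * (B i * y ^ (β - 1))) (fun i => ?_) (fun i => ?_) ?_ ?_ ?_
  · rw [uIoc_of_le ht.1.le, ← restrict_Ioo_eq_restrict_Ioc]
    exact ((ha.continuousOn_comp_sub t).mul ((hcont i).mono fun y hy => hy.1)).aestronglyMeasurable
      measurableSet_Ioo
  · filter_upwards [hmem] with y hy hm
    have hy := hy hm
    rw [norm_mul]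
    have h1 := h (t - y) ⟨sub_pos.2 hy.2, by linarith [hy.1]⟩
    exact mul_le_mul h1 (hb i y ⟨hy.1, hy.2.le.trans ht.2⟩) (norm_nonneg _)
      ((norm_nonneg _).trans h1)
  · exact ae_of_all _ fun y _ => (hB.mul_right _).mul_left _
  · simp only [tsum_mul_left, tsum_mul_right]
    refine ((intervalIntegrable_beta hα hβ ht.1).const_mul (C * ∑' i, B i)).congr ?_
    exact fun y _ => by ring
  · filter_upwards [hmem] with y hy hm
    have hy := hy hm
    refine HasSum.mul_left _ (Summable.hasSum ?_)
    exact Summable.of_norm_bounded (hB.mul_right (y ^ (β - 1)))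
      fun i => hb i y ⟨hy.1, hy.2.le.trans ht.2⟩

theorem integrable_indicator (ha : PowerBound α a) (hα : 0 < α) {t : ℝ} (ht : 0 ≤ t) :
    Integrable ((Ioo 0 t).indicator a) := by
  rw [integrable_indicator_iff measurableSet_Ioo,
    ← intervalIntegrable_iff_integrableOn_Ioo_of_le ht]
  exact ha.intervalIntegrable hα ht

open ContinuousLinearMap in
/-- Associativity of the half-line convolution.  The condition `1 ≤ α + β` makes `a * b` locally
bounded, so that the identity holds at every point, not only almost everywhere. -/
theorem lconv_assoc (ha : PowerBound α a) (hα : 0 < α) (hb : PowerBound β b) (hβ : 0 < β)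
    (hαβ : 1 ≤ α + β) {g : ℝ → ℂ} {t : ℝ} (ht : 0 ≤ t) (hg : IntervalIntegrable g volume 0 t) :
    lconv a (lconv b g) t = lconv (lconv a b) g t := by
  rcases ht.eq_or_lt with rfl | ht0
  · simp
  -- Truncating to `(0, t)` turns the three functions into integrable functions on the line.
  set A := (Ioo 0 t).indicator a with hA
  set B := (Ioo 0 t).indicator b with hB
  set G := (Ioo 0 t).indicator g with hG
  have iA : Integrable A := ha.integrable_indicator hα ht
  have iB : Integrable B := hb.integrable_indicator hβ ht
  have iG : Integrable G := by
    rw [hG, integrable_indicator_iff measurableSet_Ioo,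
      ← intervalIntegrable_iff_integrableOn_Ioo_of_le ht]
    exact hg
  have hconv : ∀ (f h : ℝ → ℂ) {s : ℝ}, s ∈ Ioo 0 t →
      convolution ((Ioo 0 t).indicator f) ((Ioo 0 t).indicator h) (mul ℝ ℂ) volume s =
        lconv h f s := by
    intro f h s hs
    rw [convolution_def, lconv_eq_setIntegral _ _ hs.1.le, ← integral_indicator measurableSet_Ioo]
    refine integral_congr_ae ?_
    have hne : ∀ᵐ y : ℝ, y ≠ s := by simp [ae_iff]
    filter_upwards [hne] with y hy
    simp only [mul_apply']
    by_cases h1 : y ∈ Ioo 0 s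
    · rw [indicator_of_mem h1, indicator_of_mem (show y ∈ Ioo 0 t from ⟨h1.1, h1.2.trans hs.2⟩),
        indicator_of_mem (show s - y ∈ Ioo 0 t from ⟨sub_pos.2 h1.2, by linarith [h1.1, hs.2]⟩),
        mul_comm]
    · rw [indicator_of_notMem h1]
      by_cases h2 : 0 < y
      · have h3 : s - y ∉ Ioo 0 t := fun h4 => h1 ⟨h2, by linarith [h4.1]⟩
        rw [indicator_of_notMem h3, mul_zero]
      · have h3 : y ∉ Ioo 0 t := fun h4 => h2 h4.1
        rw [indicator_of_notMem h3, zero_mul]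
  have hfin : ∀ {H H' : ℝ → ℂ}, (∀ s ∈ Ioo 0 t, H s = H' s) → ∀ f : ℝ → ℂ,
      convolution H ((Ioo 0 t).indicator f) (mul ℝ ℂ) volume t = lconv f H' t := by
    intro H H' hH f
    rw [convolution_def, lconv_eq_setIntegral _ _ ht, ← integral_indicator measurableSet_Ioo]
    refine integral_congr_ae (Eventually.of_forall fun y => ?_)
    simp only [mul_apply']
    by_cases h1 : y ∈ Ioo 0 t
    · rw [indicator_of_mem h1, hH y h1,
        indicator_of_mem (show t - y ∈ Ioo 0 t from ⟨sub_pos.2 h1.2, by linarith [h1.1]⟩), mul_comm]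
    · have h3 : t - y ∉ Ioo 0 t := fun h4 => h1 ⟨by linarith [h4.2], by linarith [h4.1]⟩
      rw [indicator_of_notMem h1, indicator_of_notMem h3, mul_zero]
  have hfin' : ∀ {H H' : ℝ → ℂ}, (∀ s ∈ Ioo 0 t, H s = H' s) → ∀ f : ℝ → ℂ,
      convolution ((Ioo 0 t).indicator f) H (mul ℝ ℂ) volume t = lconv H' f t := by
    intro H H' hH f
    rw [convolution_def, lconv_eq_setIntegral _ _ ht, ← integral_indicator measurableSet_Ioo]
    refine integral_congr_ae (Eventually.of_forall fun y => ?_)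
    simp only [mul_apply']
    by_cases h1 : y ∈ Ioo 0 t
    · rw [indicator_of_mem h1, indicator_of_mem h1,
        hH (t - y) ⟨sub_pos.2 h1.2, by linarith [h1.1]⟩, mul_comm]
    · rw [indicator_of_notMem h1, indicator_of_notMem h1, zero_mul]
  obtain ⟨C, hC, hCa⟩ := ha.bound t
  obtain ⟨D, hD, hDb⟩ := hb.bound t
  set K := C * D * (t ^ (α + β - 1) * (Real.Gamma α * Real.Gamma β / Real.Gamma (α + β))) with hK
  -- The convolution of the absolute values is bounded on `(0, t)`.
  have hbd : ∀ s ∈ Ioo 0 t,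
      ‖convolution (fun x => ‖B x‖) (fun x => ‖A x‖) (mul ℝ ℝ) volume s‖ ≤ K := by
    intro s hs
    have hnn : 0 ≤ convolution (fun x => ‖B x‖) (fun x => ‖A x‖) (mul ℝ ℝ) volume s := by
      rw [convolution_def]
      exact integral_nonneg fun y => mul_nonneg (norm_nonneg _) (norm_nonneg _)
    rw [Real.norm_of_nonneg hnn, convolution_def]
    have hib := (intervalIntegrable_beta hα hβ hs.1).const_mul (C * D)
    rw [intervalIntegrable_iff_integrableOn_Ioo_of_le hs.1.le] at hib
    calc ∫ y, (mul ℝ ℝ) ‖B y‖ ‖A (s - y)‖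
        ≤ ∫ y, (Ioo 0 s).indicator
            (fun y => C * D * ((s - y) ^ (α - 1) * y ^ (β - 1))) y := by
          refine integral_mono_of_nonneg
            (Eventually.of_forall fun y => mul_nonneg (norm_nonneg _) (norm_nonneg _)) ?_ ?_
          · exact (integrable_indicator_iff measurableSet_Ioo).2 hib
          · have hne : ∀ᵐ y : ℝ, y ≠ s := by simp [ae_iff]
            filter_upwards [hne] with y hy
            simp only [mul_apply']
            by_cases h1 : y ∈ Ioo 0 s
            · have h2 : y ∈ Ioo 0 t := ⟨h1.1, h1.2.trans hs.2⟩
              have h3 : s - y ∈ Ioo 0 t := ⟨sub_pos.2 h1.2, by linarith [h1.1, hs.2]⟩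
              rw [indicator_of_mem h1, hA, hB, indicator_of_mem h2, indicator_of_mem h3]
              have h4 := hDb y ⟨h2.1, h2.2.le⟩
              have h5 := hCa (s - y) ⟨h3.1, h3.2.le⟩
              calc _ ≤ (D * y ^ (β - 1)) * (C * (s - y) ^ (α - 1)) :=
                    mul_le_mul h4 h5 (norm_nonneg _) ((norm_nonneg _).trans h4)
                _ = _ := by ring
            · rw [indicator_of_notMem h1]
              by_cases h2 : 0 < y
              · have h3 : s - y ∉ Ioo 0 t := fun h4 => h1 ⟨h2, by linarith [h4.1]⟩
                rw [hA, indicator_of_notMem h3, norm_zero, mul_zero]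
              · have h3 : y ∉ Ioo 0 t := fun h4 => h2 h4.1
                rw [hB, indicator_of_notMem h3, norm_zero, zero_mul]
      _ = C * D * (s ^ (α + β - 1) * (Real.Gamma α * Real.Gamma β / Real.Gamma (α + β))) := by
          rw [integral_indicator measurableSet_Ioo, integral_const_mul, ← integral_beta hα hβ hs.1,
            intervalIntegral.integral_of_le hs.1.le, integral_Ioc_eq_integral_Ioo]
      _ ≤ K := by
          have h1 := Real.Gamma_pos_of_pos hα
          have h2 := Real.Gamma_pos_of_pos hβ
          have h3 := Real.Gamma_pos_of_pos (add_pos hα hβ)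
          have h4 : s ^ (α + β - 1) ≤ t ^ (α + β - 1) :=
            Real.rpow_le_rpow hs.1.le hs.2.le (by linarith)
          rw [hK]
          gcongr
  have hassoc := convolution_assoc (mul ℝ ℂ) (mul ℝ ℂ) (mul ℝ ℂ) (mul ℝ ℂ)
    (fun x y z => mul_assoc x y z) (f := G) (g := B) (k := A) (μ := volume) (ν := volume)
    (x₀ := t) iG.1 iB.1 iA.1 (iG.ae_convolution_exists (mul ℝ ℂ) iB)
    (iB.norm.ae_convolution_exists (mul ℝ ℝ) iA.norm) ?_
  · rw [hfin (fun s hs => hconv g b hs) a, hfin' (fun s hs => hconv b a hs) g] at hassoc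
    exact hassoc
  · have iBA := iB.norm.integrable_convolution (mul ℝ ℝ) iA.norm
    have hmeas := iBA.1.comp_quasiMeasurePreserving
      (quasiMeasurePreserving_sub_left_of_right_invariant volume t)
    refine Integrable.mono' (iG.norm.mul_const K) (iG.norm.1.mul hmeas) ?_
    refine Eventually.of_forall fun y => ?_
    simp only [mul_apply', norm_mul, norm_norm]
    by_cases h1 : y ∈ Ioo 0 t
    · gcongr
      exact hbd (t - y) ⟨sub_pos.2 h1.2, by linarith [h1.1]⟩
    · rw [hG, indicator_of_notMem h1]
      simp

end PowerBound

theorem lconv_lconv_of_eqOn {α β : ℝ} {a b c : ℝ → ℂ} (ha : PowerBound α a) (hα : 0 < α)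
    (hb : PowerBound β b) (hβ : 0 < β) (hαβ : 1 ≤ α + β) (hc : EqOn (lconv a b) c (Ioi 0))
    {g : ℝ → ℂ} {t : ℝ} (ht : 0 ≤ t) (hg : IntervalIntegrable g volume 0 t) :
    lconv a (lconv b g) t = lconv c g t :=
  (ha.lconv_assoc hα hb hβ hαβ ht hg).trans
    (lconv_congr ht (hc.mono fun _ hy => hy.1) fun _ _ => rfl)

theorem powerBound_phi (s : ℂ) : PowerBound s.re (phi s) := by
  refine ⟨?_, fun T => ⟨‖(Complex.Gamma s)⁻¹‖, norm_nonneg _, fun t ht => ?_⟩⟩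
  · intro t ht
    refine ContinuousAt.continuousWithinAt ?_
    unfold phi
    refine ContinuousAt.mul_const ?_ _
    exact Complex.continuousAt_ofReal_cpow_const t (s - 1) (Or.inr (ne_of_gt ht))
  · rw [phi, norm_mul, norm_ofReal_cpow ht.1, mul_comm]
    simp

/-- Convolution adds the exponents of normalised powers: this is the Beta integral. -/
theorem lconv_phi_phi {s s' : ℂ} (hs : 0 < s.re) (hs' : 0 < s'.re) {t : ℝ} (ht : 0 < t) :
    lconv (phi s) (phi s') t = phi (s + s') t := by
  have h := Complex.betaIntegral_scaled s' s ht
  have hG := Complex.Gamma_mul_Gamma_eq_betaIntegral hs' hs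
  have h1 := Complex.Gamma_ne_zero_of_re_pos hs
  have h2 := Complex.Gamma_ne_zero_of_re_pos hs'
  have h3 : Complex.Gamma (s' + s) ≠ 0 :=
    Complex.Gamma_ne_zero_of_re_pos (by rw [Complex.add_re]; linarith)
  have h4 : lconv (phi s) (phi s') t = ((Complex.Gamma s)⁻¹ * (Complex.Gamma s')⁻¹) *
      ∫ y in (0 : ℝ)..t, (y : ℂ) ^ (s' - 1) * ((t : ℂ) - y) ^ (s - 1) := by
    rw [lconv, ← intervalIntegral.integral_const_mul]
    refine intervalIntegral.integral_congr fun y _ => ?_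
    simp only [phi]
    push_cast
    ring
  rw [h4, h, phi, add_comm s]
  field_simp
  linear_combination (-(t : ℂ) ^ (s' + s - 1)) * hG

theorem hasDerivAt_phi (s : ℂ) {t : ℝ} (ht : 0 < t) :
    HasDerivAt (phi (s + 1)) (phi s t) t := by
  have hg := Complex.one_div_Gamma_eq_self_mul_one_div_Gamma_add_one s
  unfold phi
  rw [hg, add_sub_cancel_right, ← mul_assoc, mul_comm _ s]
  refine HasDerivAt.mul_const ?_ _
  by_cases hs : s = 0
  · subst hs
    simpa using hasDerivAt_const t (1 : ℂ)
  · have := hasDerivAt_ofReal_cpow_const' ht.ne' (r := s - 1) (by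
      intro h; apply hs; linear_combination h)
    rw [sub_add_cancel] at this
    have h2 := this.const_mul s
    refine h2.congr_of_eventuallyEq (Eventually.of_forall fun y => ?_)
    simp only
    field_simp

theorem phi_one {t : ℝ} : phi 1 t = 1 := by simp [phi]

theorem lconv_phi_one (g : ℝ → ℂ) (t : ℝ) : lconv (phi 1) g t = ∫ y in (0 : ℝ)..t, g y := by
  simp [lconv, phi_one]

/-! ### Dominated series of power-bounded functions -/

/-- A series of functions, continuous on `(0, ∞)`, which on each `(0, T]` is dominated by
`t ^ (β - 1)` times a convergent series of constants. -/
structure DominatedSeries (β : ℝ) (b : ℕ → ℝ → ℂ) : Prop where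
  cont : ∀ i, ContinuousOn (b i) (Ioi 0)
  bound : ∀ T : ℝ, ∃ B : ℕ → ℝ, Summable B ∧ ∀ i, ∀ t ∈ Ioc 0 T, ‖b i t‖ ≤ B i * t ^ (β - 1)

namespace DominatedSeries

variable {β : ℝ} {b : ℕ → ℝ → ℂ}

theorem summable (hb : DominatedSeries β b) {t : ℝ} (ht : 0 < t) :
    Summable fun i => b i t := by
  obtain ⟨B, hB, h⟩ := hb.bound t
  exact Summable.of_norm_bounded (hB.mul_right (t ^ (β - 1))) fun i => h i t ⟨ht, le_rfl⟩

theorem powerBound (hb : DominatedSeries β b) : PowerBound β fun t => ∑' i, b i t := by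
  refine ⟨fun t ht => ?_, fun T => ?_⟩
  · have ht0 : (0 : ℝ) < t := ht
    obtain ⟨B, hB, h⟩ := hb.bound (2 * t)
    have hcont : ContinuousOn (fun s : ℝ => s ^ (β - 1)) (Icc (t / 2) (2 * t)) := fun s hs =>
      (Real.continuousAt_rpow_const s (β - 1)
        (Or.inl (by linarith [hs.1]))).continuousWithinAt
    obtain ⟨D, hD⟩ := isCompact_Icc.exists_bound_of_continuousOn hcont
    have hsub : Ioo (t / 2) (2 * t) ⊆ Ioi 0 := fun s hs => by
      have := hs.1
      exact lt_trans (by positivity) this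
    have hsum : ContinuousOn (fun t => ∑' i, b i t) (Ioo (t / 2) (2 * t)) := by
      refine continuousOn_tsum (fun i => (hb.cont i).mono hsub) (hB.norm.mul_right D)
        fun i s hs => ?_
      have h1 := h i s ⟨hsub hs, hs.2.le⟩
      have h2 := hD s ⟨hs.1.le, hs.2.le⟩
      calc ‖b i s‖ ≤ ‖B i * s ^ (β - 1)‖ := h1.trans (le_abs_self _)
        _ ≤ ‖B i‖ * D := by rw [norm_mul]; gcongr
    exact (hsum.continuousAt (Ioo_mem_nhds (by linarith) (by linarith))).continuousWithinAt
  · obtain ⟨B, hB, h⟩ := hb.bound T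
    refine ⟨∑' i, ‖B i‖, tsum_nonneg fun i => norm_nonneg _, fun t ht => ?_⟩
    rw [← tsum_mul_right]
    refine tsum_of_norm_bounded (hB.norm.mul_right _).hasSum fun i => (h i t ht).trans ?_
    exact mul_le_mul_of_nonneg_right (le_abs_self _) (Real.rpow_nonneg ht.1.le _)

theorem hasSum_lconv (hb : DominatedSeries β b) (hβ : 0 < β) {α : ℝ} {a : ℝ → ℂ}
    (ha : PowerBound α a) (hα : 0 < α) {t : ℝ} (ht : 0 < t) :
    HasSum (fun i => lconv a (b i) t) (lconv a (fun s => ∑' i, b i s) t) := by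
  obtain ⟨B, hB, h⟩ := hb.bound t
  exact ha.hasSum_lconv hα hβ hB hb.cont h ⟨ht, le_rfl⟩

end DominatedSeries

/-! ### Prabhakar kernels -/

theorem kernel_eq_tsum (m q r l : ℂ) {t : ℝ} (ht : 0 < t) :
    kernel m q r l t = ∑' u : ℕ, coef l u * r ^ u * phi (q + u * m) t := by
  have ht' : (t : ℂ) ≠ 0 := Complex.ofReal_ne_zero.2 ht.ne'
  rw [kernel, fn, ← tsum_mul_left]
  refine tsum_congr fun u => ?_
  rw [phi, coef, add_sub_right_comm, Complex.cpow_add _ _ ht', Complex.cpow_nat_mul, mul_pow,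
    mul_comm m, add_comm q]
  simp only [div_eq_mul_inv, mul_inv]
  ring

/-- The geometric bound for the terms of the double series. -/
theorem exists_norm_term_le {m n q : ℂ} (hm : 0 < m.re) (hn : 0 < n.re) (hq : 0 < q.re)
    (r l l₀ A : ℂ) (T : ℝ) :
    ∃ C, 0 ≤ C ∧ ∀ j u : ℕ, ∀ t ∈ Ioc 0 T,
      ‖A ^ j * (coef (l₀ + j * l) u * r ^ u * phi (q + j * n + u * m) t)‖ ≤
        C * (1 / 2) ^ j * (1 / 2) ^ u * t ^ (q.re - 1) := by
  obtain ⟨N, hN⟩ := exists_nat_ge ‖l‖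
  obtain ⟨N₀, hN₀⟩ := exists_nat_ge ‖l₀‖
  set X : ℝ := ‖A‖ * 2 ^ N + 2 * ‖r‖ + 1 with hX
  have hXpos : 0 < X := by positivity
  obtain ⟨C, hC, h⟩ := exists_norm_phi_le hm hn hq T (ε := 1 / 2 / X) (by positivity)
  refine ⟨2 ^ N₀ * C, by positivity, fun j u t ht => ?_⟩
  have hcoef : ‖coef (l₀ + j * l) u‖ ≤ 2 ^ (N₀ + j * N + u) := by
    refine norm_coef_le ?_ u
    push_cast
    refine (norm_add_le _ _).trans (add_le_add hN₀ ?_)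
    rw [norm_mul, Complex.norm_natCast]
    gcongr
  have h1 : ‖A‖ * 2 ^ N * (1 / 2 / X) ≤ 1 / 2 := by
    rw [mul_div_assoc', div_le_iff₀ hXpos]
    have : ‖A‖ * 2 ^ N ≤ X := by rw [hX]; linarith [norm_nonneg r]
    linarith
  have h2 : 2 * ‖r‖ * (1 / 2 / X) ≤ 1 / 2 := by
    rw [mul_div_assoc', div_le_iff₀ hXpos]
    have : 2 * ‖r‖ ≤ X := by
      rw [hX]
      have : 0 ≤ ‖A‖ * 2 ^ N := by positivity
      linarith
    linarith
  have ht0 : 0 < t := ht.1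
  rw [norm_mul, norm_mul, norm_mul, norm_pow, norm_pow]
  calc ‖A‖ ^ j * (‖coef (l₀ + j * l) u‖ * ‖r‖ ^ u * ‖phi (q + j * n + u * m) t‖)
      ≤ ‖A‖ ^ j * (2 ^ (N₀ + j * N + u) * ‖r‖ ^ u *
          (C * (1 / 2 / X) ^ j * (1 / 2 / X) ^ u * t ^ (q.re - 1))) := by
        gcongr
        exact h j u t ht
    _ = 2 ^ N₀ * C * (‖A‖ * 2 ^ N * (1 / 2 / X)) ^ j * (2 * ‖r‖ * (1 / 2 / X)) ^ u *
          t ^ (q.re - 1) := by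
        rw [pow_add, pow_add, mul_comm j N, pow_mul]
        simp only [mul_pow]
        ring
    _ ≤ _ := by gcongr

theorem dominatedSeries_kernel {m q : ℂ} (hm : 0 < m.re) (hq : 0 < q.re) (r l : ℂ) :
    DominatedSeries q.re fun u t => coef l u * r ^ u * phi (q + u * m) t := by
  refine ⟨fun u => continuousOn_const.mul (powerBound_phi _).cont, fun T => ?_⟩
  obtain ⟨C, -, h⟩ := exists_norm_term_le (n := 1) hm (by simp) hq r 0 l 1 T
  refine ⟨fun u => C * (1 / 2) ^ u, summable_geometric_two.mul_left C, fun u t ht => ?_⟩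
  simpa using h 0 u t ht

theorem PowerBound.congr {α : ℝ} {a a' : ℝ → ℂ} (ha : PowerBound α a)
    (h : EqOn a' a (Ioi 0)) : PowerBound α a' := by
  refine ⟨ha.cont.congr h, fun T => ?_⟩
  obtain ⟨C, hC, hb⟩ := ha.bound T
  exact ⟨C, hC, fun t ht => by rw [h ht.1]; exact hb t ht⟩

theorem powerBound_kernel {m q : ℂ} (hm : 0 < m.re) (hq : 0 < q.re) (r l : ℂ) :
    PowerBound q.re (kernel m q r l) :=
  (dominatedSeries_kernel hm hq r l).powerBound.congr fun _ ht => kernel_eq_tsum m q r l ht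

theorem kernel_zero_right (m q r : ℂ) {t : ℝ} (ht : 0 < t) : kernel m q r 0 t = phi q t := by
  rw [kernel_eq_tsum m q r 0 ht, tsum_eq_single 0]
  · simp [coef_zero_left]
  · intro u hu
    simp [coef_zero_left, hu]

theorem tsum_tsum_add_eq_tsum_sum_antidiagonal {f g Φ : ℕ → ℂ}
    (h : Summable fun x : ℕ × ℕ => f x.1 * g x.2 * Φ (x.1 + x.2)) :
    ∑' u, ∑' v, f u * g v * Φ (u + v) =
      ∑' w, (∑ x ∈ Finset.HasAntidiagonal.antidiagonal w, f x.1 * g x.2) * Φ w := by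
  rw [← h.tsum_prod (f := fun x : ℕ × ℕ => f x.1 * g x.2 * Φ (x.1 + x.2)),
    ← (Finset.HasAntidiagonal.sigmaAntidiagonalEquivProd (A := ℕ)).tsum_eq]
  refine ((Finset.HasAntidiagonal.sigmaAntidiagonalEquivProd
    (A := ℕ)).summable_iff.2 h).tsum_sigma.trans ?_
  refine tsum_congr fun w => ?_
  rw [tsum_fintype, Finset.sum_mul,
    ← Finset.sum_coe_sort (Finset.HasAntidiagonal.antidiagonal w)]
  refine Finset.sum_congr rfl fun x _ => ?_
  have hx := Finset.HasAntidiagonal.mem_antidiagonal.1 x.2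
  change f x.1.1 * g x.1.2 * Φ (x.1.1 + x.1.2) = _
  rw [hx]

/-- The semigroup law of Prabhakar kernels: orders and upper parameters add under convolution. -/
theorem lconv_kernel_kernel {m q q' : ℂ} (hm : 0 < m.re) (hq : 0 < q.re) (hq' : 0 < q'.re)
    (r l l' : ℂ) {t : ℝ} (ht : 0 < t) :
    lconv (kernel m q r l) (kernel m q' r l') t = kernel m (q + q') r (l + l') t := by
  have hre : ∀ {s : ℂ} (u : ℕ), 0 < s.re → 0 < (s + u * m).re := by
    intro s u hs
    have h1 : (s + u * m).re = s.re + u * m.re := by simp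
    rw [h1]
    positivity
  have h1 : ∀ v : ℕ, lconv (kernel m q r l) (fun t => coef l' v * r ^ v * phi (q' + v * m) t) t =
      ∑' u : ℕ, coef l' v * r ^ v * (coef l u * r ^ u) * phi (q + q' + (v + u : ℕ) * m) t := by
    intro v
    rw [lconv_const_mul_right, lconv_comm, lconv_congr ht.le (fun _ _ => rfl)
      (fun s hs => kernel_eq_tsum m q r l hs.1),
      ← ((dominatedSeries_kernel hm hq r l).hasSum_lconv hq (powerBound_phi (q' + v * m))
        (hre v hq') ht).tsum_eq, ← tsum_mul_left]
    refine tsum_congr fun u => ?_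
    rw [lconv_const_mul_right, lconv_phi_phi (hre v hq') (hre u hq) ht, ← mul_assoc]
    congr 2
    push_cast
    ring
  have h2 := ((dominatedSeries_kernel hm hq' r l').hasSum_lconv hq'
    (powerBound_kernel hm hq r l) hq ht).tsum_eq
  rw [lconv_congr ht.le (fun _ _ => rfl) (fun s hs => kernel_eq_tsum m q' r l' hs.1), ← h2,
    kernel_eq_tsum _ _ _ _ ht]
  simp only [h1]
  rw [tsum_tsum_add_eq_tsum_sum_antidiagonal (f := fun v => coef l' v * r ^ v)
    (g := fun u => coef l u * r ^ u) (Φ := fun w => phi (q + q' + (w : ℕ) * m) t)]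
  · refine tsum_congr fun w => ?_
    rw [add_comm l l', ← sum_antidiagonal_coef l' l w]
    congr 1
    rw [Finset.sum_mul]
    refine Finset.sum_congr rfl fun x hx => ?_
    have hw : x.1 + x.2 = w := Finset.HasAntidiagonal.mem_antidiagonal.1 hx
    rw [← hw, pow_add]
    ring
  · have hqq : 0 < (q + q').re := by rw [Complex.add_re]; linarith
    obtain ⟨N, hN⟩ := exists_nat_ge ‖l‖
    obtain ⟨N', hN'⟩ := exists_nat_ge ‖l'‖
    set X : ℝ := 2 * ‖r‖ + 1 with hX
    have hXpos : 0 < X := by positivity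
    obtain ⟨C, hC, h⟩ := exists_norm_phi_le (n := 1) hm (by simp) hqq t (ε := 1 / 2 / X)
      (by positivity)
    have h5 : 2 * ‖r‖ * (1 / 2 / X) ≤ 1 / 2 := by
      rw [mul_div_assoc', div_le_iff₀ hXpos]
      linarith
    have hs := ((summable_geometric_two.mul_of_nonneg summable_geometric_two
      (fun _ => by positivity) (fun _ => by positivity)).mul_left
        (2 ^ N * 2 ^ N' * (C * t ^ ((q + q').re - 1))))
    refine Summable.of_norm_bounded hs fun x => ?_
    have h6 := h 0 (x.1 + x.2) t ⟨ht, le_rfl⟩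
    simp only [Nat.cast_zero, add_zero, pow_zero, mul_one] at h6
    rw [norm_mul, norm_mul, norm_mul, norm_mul, norm_pow, norm_pow]
    calc ‖coef l' x.1‖ * ‖r‖ ^ x.1 * (‖coef l x.2‖ * ‖r‖ ^ x.2) *
          ‖phi (q + q' + (x.1 + x.2 : ℕ) * m) t‖
        ≤ 2 ^ (N' + x.1) * ‖r‖ ^ x.1 * (2 ^ (N + x.2) * ‖r‖ ^ x.2) *
          (C * (1 / 2 / X) ^ (x.1 + x.2) * t ^ ((q + q').re - 1)) := by
          gcongr
          · exact norm_coef_le hN' _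
          · exact norm_coef_le hN _
      _ = 2 ^ N * 2 ^ N' * (C * t ^ ((q + q').re - 1)) * ((2 * ‖r‖ * (1 / 2 / X)) ^ x.1 *
            (2 * ‖r‖ * (1 / 2 / X)) ^ x.2) := by
          rw [pow_add, pow_add, pow_add]
          simp only [mul_pow]
          ring
      _ ≤ _ := by gcongr

/-- Iterated convolution against an integrable function composes the kernels. -/
theorem lconv_kernel_lconv_kernel {m q q' : ℂ} (hm : 0 < m.re) (hq : 0 < q.re) (hq' : 0 < q'.re)
    (hqq : 1 ≤ (q + q').re) (r l l' : ℂ) {g : ℝ → ℂ} {t : ℝ} (ht : 0 ≤ t)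
    (hg : IntervalIntegrable g volume 0 t) :
    lconv (kernel m q r l) (lconv (kernel m q' r l') g) t =
      lconv (kernel m (q + q') r (l + l')) g t :=
  lconv_lconv_of_eqOn (powerBound_kernel hm hq r l) hq (powerBound_kernel hm hq' r l') hq'
    hqq (fun _ hs => lconv_kernel_kernel hm hq hq' r l l' hs) ht hg

/-! ### Series of Prabhakar kernels -/

/-- The series `∑ⱼ A^j e^{l₀ + j l}_{m, q + j n}(t)` of Prabhakar kernels. -/
noncomputable def kernelSeries (m n r l A : ℂ) (q l₀ : ℂ) (t : ℝ) : ℂ :=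
  ∑' j : ℕ, A ^ j * kernel m (q + j * n) r (l₀ + j * l) t

theorem dominatedSeries_kernelSeries {m n q : ℂ} (hm : 0 < m.re) (hn : 0 < n.re) (hq : 0 < q.re)
    (r l A l₀ : ℂ) :
    DominatedSeries q.re fun j t => A ^ j * kernel m (q + j * n) r (l₀ + j * l) t := by
  refine ⟨fun j => continuousOn_const.mul (powerBound_kernel hm ?_ r _).cont, fun T => ?_⟩
  · have h1 : (q + j * n).re = q.re + j * n.re := by simp
    rw [h1]
    positivity
  obtain ⟨C, hC, h⟩ := exists_norm_term_le hm hn hq r l l₀ A T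
  refine ⟨fun j => C * 2 * (1 / 2) ^ j, summable_geometric_two.mul_left _, fun j t ht => ?_⟩
  simp only
  rw [kernel_eq_tsum _ _ _ _ ht.1, ← tsum_mul_left]
  have h2 := (summable_geometric_two.mul_left (C * (1 / 2) ^ j)).mul_right (t ^ (q.re - 1))
  refine (tsum_of_norm_bounded h2.hasSum fun u => h j u t ht).trans_eq ?_
  rw [tsum_mul_right, tsum_mul_left, tsum_geometric_two]
  ring

theorem powerBound_kernelSeries {m n q : ℂ} (hm : 0 < m.re) (hn : 0 < n.re) (hq : 0 < q.re)
    (r l A l₀ : ℂ) : PowerBound q.re (kernelSeries m n r l A q l₀) :=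
  (dominatedSeries_kernelSeries hm hn hq r l A l₀).powerBound

theorem lconv_kernel_kernelSeries {m n q q' : ℂ} (hm : 0 < m.re) (hn : 0 < n.re)
    (hq : 0 < q.re) (hq' : 0 < q'.re) (r l A l₀ l' : ℂ) {t : ℝ} (ht : 0 < t) :
    lconv (kernel m q' r l') (kernelSeries m n r l A q l₀) t =
      kernelSeries m n r l A (q' + q) (l' + l₀) t := by
  have h := ((dominatedSeries_kernelSeries hm hn hq r l A l₀).hasSum_lconv hq
    (powerBound_kernel hm hq' r l') hq' ht).tsum_eq
  unfold kernelSeries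
  rw [← h]
  refine tsum_congr fun j => ?_
  have h1 : 0 < (q + j * n).re := by
    have h1 : (q + j * n).re = q.re + j * n.re := by simp
    rw [h1]
    positivity
  rw [lconv_const_mul_right, lconv_kernel_kernel hm hq' h1 r _ _ ht, add_assoc, add_assoc]

theorem kernelSeries_eq_add {m n q : ℂ} (hm : 0 < m.re) (hn : 0 < n.re) (hq : 0 < q.re)
    (r l A l₀ : ℂ) {t : ℝ} (ht : 0 < t) :
    kernelSeries m n r l A q l₀ t =
      kernel m q r l₀ t + A * kernelSeries m n r l A (q + n) (l₀ + l) t := by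
  unfold kernelSeries
  rw [((dominatedSeries_kernelSeries hm hn hq r l A l₀).summable ht).tsum_eq_zero_add,
    ← tsum_mul_left]
  congr 1
  · simp
  · refine tsum_congr fun j => ?_
    rw [pow_succ']
    push_cast
    rw [show q + ((j : ℂ) + 1) * n = q + n + j * n by ring,
      show l₀ + ((j : ℂ) + 1) * l = l₀ + l + j * l by ring, mul_assoc]

theorem kernelSeries_add_one {m n q : ℂ} (hm : 0 < m.re) (hn : 0 < n.re)
    (hq : 0 < q.re) (r l A l₀ : ℂ) {t : ℝ} (ht : 0 < t) :
    kernelSeries m n r l A (q + 1) l₀ t =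
      ∫ y in (0 : ℝ)..t, kernelSeries m n r l A q l₀ y := by
  have h := lconv_kernel_kernelSeries hm hn hq (q' := 1) (by simp) r l A l₀ 0 ht
  rw [zero_add, add_comm 1 q] at h
  rw [← h, ← lconv_phi_one]
  exact lconv_congr ht.le (fun s hs => kernel_zero_right m 1 r hs.1) fun _ _ => rfl

theorem hasDerivAt_kernelSeries {m n q : ℂ} (hm : 0 < m.re) (hn : 0 < n.re)
    (hq : 0 < q.re) (r l A l₀ : ℂ) {t : ℝ} (ht : 0 < t) :
    HasDerivAt (kernelSeries m n r l A (q + 1) l₀) (kernelSeries m n r l A q l₀ t) t := by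
  have hp := powerBound_kernelSeries hm hn hq r l A l₀
  have h := intervalIntegral.integral_hasDerivAt_right (hp.intervalIntegrable hq ht.le)
    (hp.cont.stronglyMeasurableAtFilter isOpen_Ioi t ht)
    (hp.cont.continuousAt (Ioi_mem_nhds ht))
  refine h.congr_of_eventuallyEq ?_
  filter_upwards [Ioi_mem_nhds ht] with s hs
  exact kernelSeries_add_one hm hn hq r l A l₀ hs

end Prabhakar

/-! ### Absolutely continuous complex-valued functions -/

namespace AbsolutelyContinuousOnInterval

theorem lipschitz_comp {X Y : Type*} [PseudoMetricSpace X] [PseudoMetricSpace Y] {ψ : X → Y}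
    {K : NNReal} (hψ : LipschitzWith K ψ) {f : ℝ → X} {a b : ℝ}
    (hf : AbsolutelyContinuousOnInterval f a b) :
    AbsolutelyContinuousOnInterval (fun t => ψ (f t)) a b := by
  refine squeeze_zero (fun E => Finset.sum_nonneg fun i _ => dist_nonneg) (fun E => ?_)
    (by simpa using! Filter.Tendsto.const_mul (K : ℝ) hf)
  rw [Finset.mul_sum]
  exact Finset.sum_le_sum fun i _ => hψ.dist_le_mul _ _

theorem congr {X : Type*} [PseudoMetricSpace X] {f g : ℝ → X} {a b : ℝ}
    (hf : AbsolutelyContinuousOnInterval f a b) (h : EqOn g f (uIcc a b)) :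
    AbsolutelyContinuousOnInterval g a b := by
  refine Tendsto.congr' ?_ hf
  filter_upwards [mem_inf_of_right (mem_principal_self _)] with E hE
  refine Finset.sum_congr rfl fun i hi => ?_
  rw [h (hE.1 i hi).1, h (hE.1 i hi).2]

theorem of_re_im {f : ℝ → ℂ} {a b : ℝ}
    (hre : AbsolutelyContinuousOnInterval (fun t => (f t).re) a b)
    (him : AbsolutelyContinuousOnInterval (fun t => (f t).im) a b) :
    AbsolutelyContinuousOnInterval f a b := by
  have h1 := hre.lipschitz_comp Complex.isometry_ofReal.lipschitz
  have h2 := (him.lipschitz_comp Complex.isometry_ofReal.lipschitz).const_smul Complex.I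
  refine (h1.add h2).congr fun t _ => ?_
  simp only [Pi.add_apply, smul_eq_mul, mul_comm Complex.I]
  exact (Complex.re_add_im (f t)).symm

theorem of_integral {f : ℝ → ℂ} {a b : ℝ} (hf : IntervalIntegrable f volume a b) :
    AbsolutelyContinuousOnInterval (fun t => ∫ y in a..t, f y) a b := by
  have hsub : ∀ t ∈ uIcc a b, IntervalIntegrable f volume a t := fun t ht =>
    hf.mono_set (uIcc_subset_uIcc left_mem_uIcc ht)
  have hre : IntervalIntegrable (fun y => (f y).re) volume a b :=
    ⟨hf.1.re, hf.2.re⟩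
  have him : IntervalIntegrable (fun y => (f y).im) volume a b :=
    ⟨hf.1.im, hf.2.im⟩
  refine of_re_im ?_ ?_
  · refine (hre.absolutelyContinuousOnInterval_intervalIntegral left_mem_uIcc).congr
      fun t ht => ?_
    exact (Complex.reCLM.intervalIntegral_comp_comm (hsub t ht)).symm
  · refine (him.absolutelyContinuousOnInterval_intervalIntegral left_mem_uIcc).congr
      fun t ht => ?_
    exact (Complex.imCLM.intervalIntegral_comp_comm (hsub t ht)).symm

/-- An absolutely continuous complex-valued function is the integral of its derivative. -/
theorem intervalIntegrable_deriv_and_integral_eq {f : ℝ → ℂ} {a b : ℝ}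
    (hf : AbsolutelyContinuousOnInterval f a b) :
    IntervalIntegrable (deriv f) volume a b ∧ ∫ t in a..b, deriv f t = f b - f a := by
  have hre := hf.lipschitz_comp (ψ := Complex.re) (K := 1)
    (LipschitzWith.of_dist_le_mul fun x y => by
      simpa [dist_eq_norm] using Complex.abs_re_le_norm (x - y))
  have him := hf.lipschitz_comp (ψ := Complex.im) (K := 1)
    (LipschitzWith.of_dist_le_mul fun x y => by
      simpa [dist_eq_norm] using Complex.abs_im_le_norm (x - y))
  have hre' := hre.intervalIntegrable_deriv
  have him' := him.intervalIntegrable_deriv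
  have hae : ∀ᵐ t, t ∈ uIcc a b → deriv f t =
      ((deriv (fun t => (f t).re) t : ℝ) : ℂ) + (deriv (fun t => (f t).im) t : ℝ) * Complex.I := by
    filter_upwards [hre.ae_differentiableAt, him.ae_differentiableAt] with t h1 h2 ht
    have h3 := (h1 ht).hasDerivAt.ofReal_comp.add
      ((h2 ht).hasDerivAt.ofReal_comp.mul_const Complex.I)
    refine HasDerivAt.deriv (h3.congr_of_eventuallyEq (Eventually.of_forall fun s => ?_))
    exact (Complex.re_add_im (f s)).symm
  have hae' : ∀ᵐ t, t ∈ uIoc a b → deriv f t =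
      ((deriv (fun t => (f t).re) t : ℝ) : ℂ) + (deriv (fun t => (f t).im) t : ℝ) * Complex.I := by
    filter_upwards [hae] with t h ht using h (uIoc_subset_uIcc ht)
  have i1 : IntervalIntegrable (fun t => ((deriv (fun t => (f t).re) t : ℝ) : ℂ)) volume a b :=
    ⟨hre'.1.ofReal, hre'.2.ofReal⟩
  have i2 : IntervalIntegrable
      (fun t => ((deriv (fun t => (f t).im) t : ℝ) : ℂ) * Complex.I) volume a b :=
    IntervalIntegrable.mul_const ⟨him'.1.ofReal, him'.2.ofReal⟩ _
  constructor
  · refine (i1.add i2).congr_ae ?_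
    rw [EventuallyEq, ae_restrict_iff' measurableSet_uIoc]
    filter_upwards [hae'] with t h ht using (h ht).symm
  · rw [intervalIntegral.integral_congr_ae hae', intervalIntegral.integral_add i1 i2,
      intervalIntegral.integral_mul_const, intervalIntegral.integral_ofReal,
      intervalIntegral.integral_ofReal, hre.integral_deriv_eq_sub, him.integral_deriv_eq_sub]
    apply Complex.ext <;> simp

end AbsolutelyContinuousOnInterval

namespace Prabhakar

/-! ### Chains of derivatives -/

theorem iteratedDeriv_eq_of_chain {s : Set ℝ} (hs : IsOpen s) {N : ℕ} {F : ℕ → ℝ → ℂ}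
    (h : ∀ i < N, ∀ t ∈ s, HasDerivAt (F i) (F (i + 1) t) t) {i : ℕ} (hi : i ≤ N) :
    EqOn (iteratedDeriv i (F 0)) (F i) s := by
  induction i with
  | zero => intro t _; simp
  | succ i ih =>
    intro t ht
    rw [iteratedDeriv_succ]
    refine ((h i (by omega) t ht).congr_of_eventuallyEq ?_).deriv
    filter_upwards [hs.mem_nhds ht] with y hy using ih (by omega) hy

theorem contDiffOn_of_chain {s : Set ℝ} (hs : IsOpen s) {N : ℕ} {F : ℕ → ℝ → ℂ}
    (h : ∀ i < N, ∀ t ∈ s, HasDerivAt (F i) (F (i + 1) t) t) (hc : ContinuousOn (F N) s) :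
    ContDiffOn ℝ ((N : ℕ∞) : WithTop ℕ∞) (F 0) s := by
  induction N generalizing F with
  | zero => simpa using hc
  | succ N ih =>
    have h1 := ih (F := fun i => F (i + 1)) (fun i hi t ht => h (i + 1) (by omega) t ht) hc
    have h2 : (((N + 1 : ℕ) : ℕ∞) : WithTop ℕ∞) = ((N : ℕ∞) : WithTop ℕ∞) + 1 := by
      push_cast; rfl
    rw [h2, contDiffOn_succ_iff_deriv_of_isOpen hs]
    refine ⟨fun t ht => (h 0 (by omega) t ht).differentiableAt.differentiableWithinAt,
      by simp, h1.congr fun t ht => (h 0 (by omega) t ht).deriv⟩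

/-! ### The series solves the scalar Cauchy problem -/

theorem order_pos {n : ℂ} (hn : 0 < n.re) : 0 < order n := Nat.ceil_pos.2 hn

theorem re_le_order (n : ℂ) : n.re ≤ order n := Nat.le_ceil _

theorem lt_re_of_lt_order {n : ℂ} {i : ℕ} (hi : i < order n) : (i : ℝ) < n.re :=
  Nat.lt_ceil.1 hi

/-- The `i`-th derivative of `t ^ p / p!` vanishes for `i > p`: `1 / Γ` is `0` at the poles
of `Γ`. -/
theorem phi_eq_zero {p i : ℕ} (h : p < i) (t : ℝ) : phi (p + 1 - i) t = 0 := by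
  obtain ⟨d, rfl⟩ := Nat.exists_eq_add_of_lt h
  have h1 : (p : ℂ) + 1 - ((p + d + 1 : ℕ) : ℂ) = -(d : ℂ) := by push_cast; ring
  rw [phi, h1, Complex.Gamma_neg_nat_eq_zero, inv_zero, mul_zero]

theorem PowerBound.tendsto_zero {α : ℝ} {a : ℝ → ℂ} (ha : PowerBound α a) (hα : 1 < α) :
    Tendsto a (𝓝[>] 0) (𝓝 0) := by
  obtain ⟨C, hC, h⟩ := ha.bound 1
  refine squeeze_zero_norm' (a := fun t => C * t ^ (α - 1)) ?_ ?_
  · filter_upwards [Ioc_mem_nhdsGT zero_lt_one] with t ht using h t ht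
  · have h1 : Tendsto (fun t : ℝ => t ^ (α - 1)) (𝓝[>] 0) (𝓝 (0 ^ (α - 1))) :=
      ((Real.continuousAt_rpow_const 0 (α - 1) (Or.inr (by linarith))).tendsto).mono_left
        nhdsWithin_le_nhds
    rw [Real.zero_rpow (by linarith)] at h1
    simpa using h1.const_mul C

/-- The solution `∑_{p<k} τ_p ∑ⱼ A^j e^{jl}_{m, p + 1 + jn}` of the scalar problem. -/
noncomputable def sol (m n r l A : ℂ) (τ : ℕ → ℂ) (t : ℝ) : ℂ :=
  ∑ p ∈ Finset.range (order n), kernelSeries m n r l A (p + 1) 0 t * τ p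

/-- The `i`-th derivative of `sol` on `(0, ∞)`, for `i ≤ k`.  The term `j = 0` is written
separately because it turns into `0`, not into a kernel of positive order, once `i > p`. -/
noncomputable def solDeriv (m n r l A : ℂ) (τ : ℕ → ℂ) (i : ℕ) (t : ℝ) : ℂ :=
  ∑ p ∈ Finset.range (order n),
    (phi (p + 1 - i) t + A * kernelSeries m n r l A (n + p + 1 - i) l t) * τ p

section Existence

variable {m n : ℂ} (hm : 0 < m.re) (hn : 0 < n.re) (r l A : ℂ) (τ : ℕ → ℂ)
include hm hn

theorem sol_eq_solDeriv_zero : EqOn (sol m n r l A τ) (solDeriv m n r l A τ 0) (Ioi 0) := by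
  intro t ht
  refine Finset.sum_congr rfl fun p _ => ?_
  have hp : 0 < ((p : ℂ) + 1).re := by
    simp only [Complex.add_re, Complex.natCast_re, Complex.one_re]; positivity
  rw [kernelSeries_eq_add hm hn hp r l A 0 ht, kernel_zero_right _ _ _ ht]
  congr 3
  · simp
  · congr 1
    · push_cast; ring
    · simp

omit hm hn in
theorem re_sub_succ_pos {i : ℕ} (hi : i < order n) (p : ℕ) : 0 < (n + p + 1 - (i + 1 : ℕ)).re := by
  have := lt_re_of_lt_order hi
  simp only [Complex.add_re, Complex.sub_re, Complex.natCast_re, Complex.one_re, Nat.cast_add,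
    Nat.cast_one]
  have : (0 : ℝ) ≤ p := p.cast_nonneg
  linarith

theorem hasDerivAt_solDeriv {i : ℕ} (hi : i < order n) {t : ℝ} (ht : 0 < t) :
    HasDerivAt (solDeriv m n r l A τ i) (solDeriv m n r l A τ (i + 1) t) t := by
  unfold solDeriv
  refine HasDerivAt.fun_sum fun p _ => HasDerivAt.mul_const ?_ _
  have h1 := hasDerivAt_phi ((p : ℂ) + 1 - (i + 1 : ℕ)) ht
  have h2 := (hasDerivAt_kernelSeries hm hn (re_sub_succ_pos hi p) r l A l ht).const_mul A
  have e1 : (p : ℂ) + 1 - (i + 1 : ℕ) + 1 = p + 1 - i := by push_cast; ring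
  have e2 : n + p + 1 - (i + 1 : ℕ) + 1 = n + p + 1 - i := by push_cast; ring
  rw [e1] at h1
  rw [e2] at h2
  exact h1.add h2

theorem iteratedDeriv_sol {i : ℕ} (hi : i ≤ order n) :
    EqOn (iteratedDeriv i (sol m n r l A τ)) (solDeriv m n r l A τ i) (Ioi 0) := by
  intro t ht
  rw [← iteratedDeriv_eq_of_chain isOpen_Ioi
    (fun i hi t ht => hasDerivAt_solDeriv hm hn r l A τ hi ht) hi ht]
  refine Filter.EventuallyEq.iteratedDeriv_eq i ?_
  filter_upwards [isOpen_Ioi.mem_nhds ht] with s hs using sol_eq_solDeriv_zero hm hn r l A τ hs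

omit hm hn in
theorem solDeriv_order (t : ℝ) : solDeriv m n r l A τ (order n) t =
    ∑ p ∈ Finset.range (order n), A * τ p * kernelSeries m n r l A (n + p + 1 - order n) l t := by
  refine Finset.sum_congr rfl fun p hp => ?_
  rw [phi_eq_zero (Finset.mem_range.1 hp), zero_add]
  ring

omit hm in
theorem re_sub_order_pos (p : ℕ) : 0 < (n + p + 1 - order n).re := by
  have h1 := order_pos hn
  have h2 := re_sub_succ_pos (n := n) (i := order n - 1) (by omega) p
  rwa [show order n - 1 + 1 = order n by omega] at h2

theorem intervalIntegrable_solDeriv_order {t : ℝ} (ht : 0 ≤ t) :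
    IntervalIntegrable (solDeriv m n r l A τ (order n)) volume 0 t := by
  have h : solDeriv m n r l A τ (order n) = ∑ p ∈ Finset.range (order n),
      fun t => A * τ p * kernelSeries m n r l A (n + p + 1 - order n) l t := by
    ext t
    rw [solDeriv_order, Finset.sum_apply]
  rw [h]
  exact IntervalIntegrable.sum _ fun p _ =>
    ((powerBound_kernelSeries hm hn (re_sub_order_pos hn p) r l A l).intervalIntegrable
      (re_sub_order_pos hn p) ht).const_mul _

theorem intervalIntegrable_sol {t : ℝ} (ht : 0 ≤ t) :
    IntervalIntegrable (sol m n r l A τ) volume 0 t := by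
  have h : sol m n r l A τ = ∑ p ∈ Finset.range (order n),
      fun t => kernelSeries m n r l A (p + 1) 0 t * τ p := by
    ext t
    rw [sol, Finset.sum_apply]
  rw [h]
  refine IntervalIntegrable.sum _ fun p _ => ?_
  have hp : 0 < ((p : ℂ) + 1).re := by
    simp only [Complex.add_re, Complex.natCast_re, Complex.one_re]; positivity
  exact ((powerBound_kernelSeries hm hn hp r l A 0).intervalIntegrable hp ht).mul_const _

theorem lconv_iteratedDeriv_sol {q : ℂ} (hq : 0 < q.re) {t : ℝ} (ht : 0 < t) :
    lconv (kernel m q r (-l)) (iteratedDeriv (order n) (sol m n r l A τ)) t =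
      ∑ p ∈ Finset.range (order n),
        A * τ p * kernelSeries m n r l A (q + (n + p + 1 - order n)) 0 t := by
  rw [lconv_congr ht.le (fun _ _ => rfl)
    (fun s hs => (iteratedDeriv_sol hm hn r l A τ le_rfl hs.1).trans (solDeriv_order ..))]
  simp only [lconv, Finset.mul_sum]
  rw [intervalIntegral.integral_finsetSum]
  · refine Finset.sum_congr rfl fun p _ => ?_
    rw [← neg_add_cancel l,
      ← lconv_kernel_kernelSeries hm hn (re_sub_order_pos hn p) hq r l A l _ ht,
      ← lconv_const_mul_right, lconv]
  · intro p _
    exact (powerBound_kernel hm hq r (-l)).intervalIntegrable_mul hq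
      ((powerBound_kernelSeries hm hn (re_sub_order_pos hn p) r l A l).const_mul _)
      (re_sub_order_pos hn p) ht.le

theorem lconv_iteratedDeriv_sol_add_one (hk : ((order n : ℂ) - n).re = 0) {t : ℝ} (ht : 0 < t) :
    lconv (kernel m (order n - n + 1) r (-l)) (iteratedDeriv (order n) (sol m n r l A τ)) t =
      ∫ y in (0 : ℝ)..t, A * sol m n r l A τ y := by
  rw [lconv_iteratedDeriv_sol hm hn r l A τ (by rw [Complex.add_re, hk]; simp) ht]
  simp only [sol, Finset.mul_sum]
  have hp : ∀ p : ℕ, 0 < ((p : ℂ) + 1).re := fun p => by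
    simp only [Complex.add_re, Complex.natCast_re, Complex.one_re]; positivity
  rw [intervalIntegral.integral_finsetSum]
  · refine Finset.sum_congr rfl fun p _ => ?_
    rw [show (order n : ℂ) - n + 1 + (n + p + 1 - order n) = p + 1 + 1 by ring,
      kernelSeries_add_one hm hn (hp p) r l A 0 ht, ← intervalIntegral.integral_const_mul]
    exact intervalIntegral.integral_congr fun y _ => by ring
  · intro p _
    exact (((powerBound_kernelSeries hm hn (hp p) r l A 0).intervalIntegrable
      (hp p) ht.le).mul_const _).const_mul _

theorem continuousOn_sol : ContinuousOn (sol m n r l A τ) (Ioi 0) := by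
  unfold sol
  refine continuousOn_finsetSum _ fun p _ => ContinuousOn.mul ?_ continuousOn_const
  refine (powerBound_kernelSeries hm hn ?_ r l A 0).cont
  simp only [Complex.add_re, Complex.natCast_re, Complex.one_re]; positivity

/-- The equation holds at every point.  Convolution with `e^{-l}_{m,k-n}` lowers the summation index
`j` of the `k`-th derivative by one, which leaves `A` times the original series. -/
theorem regDeriv_sol {t : ℝ} (ht : 0 < t) :
    regDeriv m n r l (sol m n r l A τ) t = A * sol m n r l A τ t := by
  unfold regDeriv integral
  split_ifs with h
  · refine (lconv_iteratedDeriv_sol hm hn r l A τ h ht).trans ?_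
    rw [sol, Finset.mul_sum]
    refine Finset.sum_congr rfl fun p _ => ?_
    rw [show (order n : ℂ) - n + (n + p + 1 - order n) = p + 1 by ring]
    ring
  · have hk : ((order n : ℂ) - n).re = 0 := by
      have := re_le_order n
      simp only [Complex.sub_re, Complex.natCast_re] at h ⊢
      linarith
    have hint := ((intervalIntegrable_sol hm hn r l A τ ht.le).const_mul A)
    have hc : ContinuousOn (fun y => A * sol m n r l A τ y) (Ioi 0) :=
      continuousOn_const.mul (continuousOn_sol hm hn r l A τ)
    have hd := intervalIntegral.integral_hasDerivAt_right hint
      (hc.stronglyMeasurableAtFilter isOpen_Ioi t ht) (hc.continuousAt (Ioi_mem_nhds ht))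
    refine (hd.congr_of_eventuallyEq ?_).deriv
    filter_upwards [Ioi_mem_nhds ht] with s hs
    exact lconv_iteratedDeriv_sol_add_one hm hn r l A τ hk hs

theorem memDomain_sol : MemDomain m n r l ⊤ (sol m n r l A τ) := by
  have hpos := order_pos hn
  have hset : {t : ℝ | 0 < t ∧ (t : EReal) < ⊤} = Ioi 0 := by
    ext t; simp [EReal.coe_lt_top]
  refine ⟨⟨?_, fun c hc _ => ?_⟩, fun hk c hc _ => ?_⟩
  · rw [hset]
    refine (contDiffOn_of_chain isOpen_Ioi (F := solDeriv m n r l A τ)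
      (fun i hi t ht => hasDerivAt_solDeriv hm hn r l A τ (by omega) ht) ?_).congr
      (sol_eq_solDeriv_zero hm hn r l A τ)
    exact fun t ht => (hasDerivAt_solDeriv hm hn r l A τ
      (Nat.sub_lt hpos one_pos) ht).continuousAt.continuousWithinAt
  · -- The `(k-1)`-st derivative is a constant plus the integral of the `k`-th one.
    refine ⟨fun t => τ (order n - 1) + ∫ y in (0 : ℝ)..t, solDeriv m n r l A τ (order n) y, ?_,
      fun t ht => ?_⟩
    · have hconst : AbsolutelyContinuousOnInterval (fun _ : ℝ => τ (order n - 1)) 0 c :=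
        (LipschitzWith.const _).lipschitzOnWith.absolutelyContinuousOnInterval
      exact hconst.add (AbsolutelyContinuousOnInterval.of_integral
        (intervalIntegrable_solDeriv_order hm hn r l A τ hc.le))
    · rw [iteratedDeriv_sol hm hn r l A τ (Nat.sub_le _ _) ht.1]
      simp only [solDeriv_order]
      rw [intervalIntegral.integral_finsetSum]
      · simp only [solDeriv, add_mul, Finset.sum_add_distrib]
        congr 1
        · rw [Finset.sum_eq_single (order n - 1)]
          · rw [show ((order n - 1 : ℕ) : ℂ) + 1 - ((order n - 1 : ℕ) : ℂ) = 1 by ring, phi_one,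
              one_mul]
          · intro p hp hne
            rw [phi_eq_zero (by have := Finset.mem_range.1 hp; omega), zero_mul]
          · intro h
            exact absurd (Finset.mem_range.2 (Nat.sub_lt hpos one_pos)) h
        · refine Finset.sum_congr rfl fun p _ => ?_
          rw [intervalIntegral.integral_const_mul,
            ← kernelSeries_add_one hm hn (re_sub_order_pos hn p) r l A l ht.1, Nat.cast_sub hpos,
            show n + (p : ℂ) + 1 - ((order n : ℂ) - (1 : ℕ)) = n + p + 1 - order n + 1 by
              push_cast; ring]
          ring
      · intro p _
        exact ((powerBound_kernelSeries hm hn (re_sub_order_pos hn p) r l A l).intervalIntegrable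
          (re_sub_order_pos hn p) ht.1.le).const_mul _
  · refine (AbsolutelyContinuousOnInterval.of_integral
      ((intervalIntegrable_sol hm hn r l A τ hc.le).const_mul A)).congr fun t ht => ?_
    rw [uIcc_of_le hc.le] at ht
    rcases ht.1.eq_or_lt with rfl | h0
    · -- Both sides are integrals over the degenerate interval `[0, 0]`.
      simp [conv]
    · exact lconv_iteratedDeriv_sol_add_one hm hn r l A τ hk h0

theorem hasInitialValues_sol : HasInitialValues (order n) τ (sol m n r l A τ) := by
  intro i hi
  have heq : solDeriv m n r l A τ i =ᶠ[𝓝[>] 0] iteratedDeriv i (sol m n r l A τ) := by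
    filter_upwards [self_mem_nhdsWithin] with t ht
    exact (iteratedDeriv_sol hm hn r l A τ hi.le ht).symm
  refine Tendsto.congr' heq ?_
  have h1 : ∀ p : ℕ, Tendsto (kernelSeries m n r l A (n + p + 1 - i) l) (𝓝[>] 0) (𝓝 0) := by
    intro p
    have hre : 1 < (n + p + 1 - i).re := by
      have := re_sub_succ_pos hi p
      simp only [Complex.add_re, Complex.sub_re, Complex.natCast_re, Complex.one_re, Nat.cast_add,
        Nat.cast_one] at this ⊢
      linarith
    exact (powerBound_kernelSeries hm hn (by linarith) r l A l).tendsto_zero hre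
  have h2 : ∀ p : ℕ, Tendsto (phi (p + 1 - i)) (𝓝[>] 0) (𝓝 (if p = i then 1 else 0)) := by
    intro p
    split_ifs with hpi
    · subst hpi
      rw [show (p : ℂ) + 1 - p = 1 by ring]
      exact tendsto_const_nhds.congr fun t => phi_one.symm
    · rcases Nat.lt_or_ge p i with h | h
      · exact tendsto_const_nhds.congr fun t => (phi_eq_zero h t).symm
      · refine (powerBound_phi _).tendsto_zero ?_
        have : i + 1 ≤ p := by omega
        have : ((i + 1 : ℕ) : ℝ) ≤ p := by exact_mod_cast this
        push_cast at this
        simp only [Complex.add_re, Complex.sub_re, Complex.natCast_re, Complex.one_re]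
        linarith
  have h3 := tendsto_finsetSum (Finset.range (order n)) fun p _ =>
    ((h2 p).add ((h1 p).const_mul A)).mul_const (τ p)
  refine Tendsto.congr (fun t => rfl) (h3.trans_eq ?_)
  simp [hi]

end Existence

/-! ### Reduction of the scalar Cauchy problem to a Volterra equation -/

namespace PowerBound

variable {α : ℝ} {a g : ℝ → ℂ}

theorem intervalIntegrable_mul_of_one_le (ha : PowerBound α a) (hα : 1 ≤ α) {t : ℝ} (ht : 0 ≤ t)
    (hg : IntervalIntegrable g volume 0 t) :
    IntervalIntegrable (fun y => a (t - y) * g y) volume 0 t := by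
  obtain ⟨C, hC, h⟩ := ha.bound t
  rw [intervalIntegrable_iff_integrableOn_Ioo_of_le ht] at hg ⊢
  refine Integrable.bdd_mul (c := C * t ^ (α - 1)) hg
    ((ha.continuousOn_comp_sub t).aestronglyMeasurable measurableSet_Ioo) ?_
  refine (ae_restrict_mem measurableSet_Ioo).mono fun y hy => ?_
  refine (h (t - y) ⟨sub_pos.2 hy.2, by linarith [hy.1]⟩).trans ?_
  have h1 : 0 ≤ t - y := (sub_pos.2 hy.2).le
  have h2 : t - y ≤ t := by linarith [hy.1]
  gcongr

end PowerBound

theorem lconv_sub {a g h : ℝ → ℂ} {t : ℝ}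
    (hg : IntervalIntegrable (fun y => a (t - y) * g y) volume 0 t)
    (hh : IntervalIntegrable (fun y => a (t - y) * h y) volume 0 t) :
    lconv a (fun y => g y - h y) t = lconv a g t - lconv a h t := by
  rw [lconv, lconv, lconv, ← intervalIntegral.integral_sub hg hh]
  exact intervalIntegral.integral_congr fun y _ => by ring

theorem intervalIntegrable_of_continuousOn_of_tendsto {g : ℝ → ℂ} {v : ℂ} {c t : ℝ} (ht : 0 < t)
    (htc : t < c) (hg : ContinuousOn g (Ioo 0 c)) (hv : Tendsto g (𝓝[>] 0) (𝓝 v)) :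
    IntervalIntegrable g volume 0 t := by
  have hcont : ContinuousOn (Function.update g 0 v) (Icc 0 t) := by
    rw [continuousOn_update_iff]
    refine ⟨hg.mono fun s hs => ⟨lt_of_le_of_ne hs.1.1 (Ne.symm hs.2), hs.1.2.trans_lt htc⟩,
      fun _ => hv.mono_left (nhdsWithin_mono _ fun s hs => ?_)⟩
    exact lt_of_le_of_ne hs.1.1 (Ne.symm hs.2)
  rw [← uIcc_of_le ht.le] at hcont
  refine hcont.intervalIntegrable.congr fun s hs => ?_
  rw [uIoc_of_le ht.le] at hs
  exact Function.update_of_ne hs.1.ne' _ _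

/-- Integration by parts against a normalised power. -/
theorem lconv_phi_eq_add {g g' : ℝ → ℂ} {v : ℂ} {t : ℝ} (ht : 0 < t)
    (hg' : IntervalIntegrable g' volume 0 t)
    (hg : ∀ s ∈ Ioo 0 t, g s = v + ∫ y in (0 : ℝ)..s, g' y) (q : ℕ) :
    lconv (phi (q + 1)) g t = v * phi (q + 2) t + lconv (phi (q + 2)) g' t := by
  have hq : ((q : ℂ) + 1).re = q + 1 := by simp
  have hq0 : 0 < ((q : ℂ) + 1).re := by rw [hq]; positivity
  have hq1 : 1 ≤ ((q : ℂ) + 1).re := by rw [hq]; linarith [q.cast_nonneg (α := ℝ)]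
  have hprim : IntervalIntegrable (fun s => ∫ y in (0 : ℝ)..s, g' y) volume 0 t :=
    (intervalIntegral.continuousOn_primitive_interval' hg' left_mem_uIcc).intervalIntegrable
  have i1 := (powerBound_phi ((q : ℂ) + 1)).intervalIntegrable_mul_of_one_le hq1 ht.le
    (intervalIntegrable_const (c := v))
  have i2 := (powerBound_phi ((q : ℂ) + 1)).intervalIntegrable_mul_of_one_le hq1 ht.le hprim
  have e1 : lconv (phi (q + 1)) (fun _ => v) t = v * phi (q + 2) t := by
    have h := lconv_phi_phi hq0 (s' := 1) (by simp) ht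
    rw [show (q : ℂ) + 1 + 1 = q + 2 by ring] at h
    rw [← h, ← lconv_const_mul_right]
    exact lconv_congr ht.le (fun _ _ => rfl) fun s _ => by simp [phi_one]
  have e2 : lconv (phi (q + 1)) (fun s => ∫ y in (0 : ℝ)..s, g' y) t =
      lconv (phi (q + 2)) g' t := by
    have h := lconv_lconv_of_eqOn (powerBound_phi ((q : ℂ) + 1)) hq0 (powerBound_phi 1)
      (by simp) (c := phi (q + 2)) (by simp only [Complex.one_re]; linarith)
      (fun s hs => by
        rw [lconv_phi_phi hq0 (by simp) hs]
        congr 1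
        ring) ht.le hg'
    rw [← h]
    exact lconv_congr ht.le (fun _ _ => rfl) fun s _ => (lconv_phi_one g' s).symm
  rw [lconv_congr ht.le (fun _ _ => rfl) hg, ← e1, ← e2, lconv, lconv, lconv,
    ← intervalIntegral.integral_add i1 i2]
  exact intervalIntegral.integral_congr fun y _ => by ring

/-- `f` solves, on `(0, b)`, the complex Cauchy problem `^C D^l_{m,n,r,0+} f = A f` with initial
values `τ`. -/
structure IsScalarSolution (m n r l A : ℂ) (τ : ℕ → ℂ) (b : EReal) (f : ℝ → ℂ) : Prop where
  mem : MemDomain m n r l b f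
  init : HasInitialValues (order n) τ f
  eqn : ∀ᵐ t : ℝ, 0 < t → (t : EReal) < b → regDeriv m n r l f t = A * f t

theorem isScalarSolution_sol {m n : ℂ} (hm : 0 < m.re) (hn : 0 < n.re) (r l A : ℂ) (τ : ℕ → ℂ) :
    IsScalarSolution m n r l A τ ⊤ (sol m n r l A τ) :=
  ⟨memDomain_sol hm hn r l A τ, hasInitialValues_sol hm hn r l A τ,
    Eventually.of_forall fun _ ht _ => regDeriv_sol hm hn r l A τ ht⟩

namespace IsScalarSolution

variable {m n r l A : ℂ} {τ : ℕ → ℂ} {b : EReal} {f : ℝ → ℂ}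

theorem contDiffOn (hf : IsScalarSolution m n r l A τ b f) {c : ℝ} (hcb : (c : EReal) < b) :
    ContDiffOn ℝ ((order n - 1 : ℕ) : ℕ∞) f (Ioo 0 c) :=
  hf.mem.1.1.mono fun _ hs => ⟨hs.1, (EReal.coe_lt_coe_iff.2 hs.2).trans hcb⟩

theorem continuousOn_iteratedDeriv (hf : IsScalarSolution m n r l A τ b f) {c : ℝ}
    (hcb : (c : EReal) < b) {q : ℕ} (hq : q ≤ order n - 1) :
    ContinuousOn (iteratedDeriv q f) (Ioo 0 c) :=
  ((hf.contDiffOn hcb).continuousOn_iteratedDerivWithin (by exact_mod_cast hq)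
    isOpen_Ioo.uniqueDiffOn).congr fun _ hs => (iteratedDerivWithin_of_isOpen isOpen_Ioo hs).symm

theorem hasDerivAt_iteratedDeriv (hf : IsScalarSolution m n r l A τ b f) {c : ℝ}
    (hcb : (c : EReal) < b) {q : ℕ} (hq : q < order n - 1) {s : ℝ} (hs : s ∈ Ioo 0 c) :
    HasDerivAt (iteratedDeriv q f) (iteratedDeriv (q + 1) f s) s := by
  have h := ((hf.contDiffOn hcb).differentiableOn_iteratedDerivWithin (m := q)
    (by exact_mod_cast hq) isOpen_Ioo.uniqueDiffOn s hs).differentiableAt (isOpen_Ioo.mem_nhds hs)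
  have h2 : iteratedDeriv q f =ᶠ[𝓝 s] iteratedDerivWithin q f (Ioo 0 c) := by
    filter_upwards [isOpen_Ioo.mem_nhds hs] with y hy
    exact (iteratedDerivWithin_of_isOpen isOpen_Ioo hy).symm
  rw [iteratedDeriv_succ]
  exact (h.congr_of_eventuallyEq h2).hasDerivAt

/-- The fundamental theorem of calculus starting at `0`, where only the limits `τ q` are given.  For
`q = k - 1` it comes from the absolutely continuous extension of `f^{(k - 1)}`. -/
theorem iteratedDeriv_eq_add_integral (hf : IsScalarSolution m n r l A τ b f) {q : ℕ}
    (hq : q < order n) {t : ℝ} (ht : 0 < t) (htb : (t : EReal) < b) :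
    IntervalIntegrable (iteratedDeriv (q + 1) f) volume 0 t ∧
      iteratedDeriv q f t = τ q + ∫ y in (0 : ℝ)..t, iteratedDeriv (q + 1) f y := by
  obtain ⟨c, htc, hcb⟩ := EReal.lt_iff_exists_real_btwn.1 htb
  have htc : t < c := EReal.coe_lt_coe_iff.1 htc
  have hc : 0 < c := ht.trans htc
  rcases Nat.lt_or_ge (q + 1) (order n) with hq' | hq'
  · have hint : IntervalIntegrable (iteratedDeriv (q + 1) f) volume 0 t :=
      intervalIntegrable_of_continuousOn_of_tendsto ht htc
        (hf.continuousOn_iteratedDeriv hcb (by omega)) (hf.init (q + 1) hq')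
    refine ⟨hint, ?_⟩
    rw [intervalIntegral.integral_eq_sub_of_hasDerivAt_of_tendsto ht
      (fun s hs => hf.hasDerivAt_iteratedDeriv hcb (by omega) ⟨hs.1, hs.2.trans htc⟩) hint
      (hf.init q hq) ((((hf.continuousOn_iteratedDeriv hcb (q := q) (by omega)).continuousAt
        (isOpen_Ioo.mem_nhds ⟨ht, htc⟩)).tendsto).mono_left nhdsWithin_le_nhds)]
    ring
  · have hqe : q = order n - 1 := by omega
    obtain ⟨h, hac, heq⟩ := hf.mem.1.2 c hc hcb
    rw [← hqe] at heq
    obtain ⟨hi, he⟩ := (hac.mono (uIcc_subset_uIcc_left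
      (by rw [uIcc_of_le hc.le]; exact ⟨ht.le, htc.le⟩))).intervalIntegrable_deriv_and_integral_eq
    have hderiv : EqOn (iteratedDeriv (q + 1) f) (deriv h) (Ioo 0 c) := by
      intro s hs
      rw [iteratedDeriv_succ]
      refine Filter.EventuallyEq.deriv_eq ?_
      filter_upwards [isOpen_Ioo.mem_nhds hs] with y hy using heq hy
    have hsub : ∀ s ∈ uIoc 0 t, s ∈ Ioo 0 c := fun s hs => by
      rw [uIoc_of_le ht.le] at hs
      exact ⟨hs.1, hs.2.trans_lt htc⟩
    have h0 : h 0 = τ q := by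
      have hc0 : Tendsto h (𝓝[>] 0) (𝓝 (h 0)) := by
        have := hac.continuousOn 0 left_mem_uIcc
        rw [uIcc_of_le hc.le] at this
        refine this.tendsto.mono_left ?_
        rw [← nhdsWithin_Ioo_eq_nhdsGT hc]
        exact nhdsWithin_mono _ Ioo_subset_Icc_self
      refine tendsto_nhds_unique (hc0.congr' ?_) (hf.init q hq)
      filter_upwards [Ioo_mem_nhdsGT hc] with y hy using (heq hy).symm
    refine ⟨hi.congr fun s hs => (hderiv (hsub s hs)).symm, ?_⟩
    rw [heq ⟨ht, htc⟩, intervalIntegral.integral_congr_ae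
      (ae_of_all _ fun s hs => hderiv (hsub s hs)), he, h0]
    ring

/-- Taylor's formula with integral remainder, for the primitive of `f`. -/
theorem integral_eq_taylor (hf : IsScalarSolution m n r l A τ b f) {q : ℕ} (hq : q ≤ order n)
    {t : ℝ} (ht : 0 < t) (htb : (t : EReal) < b) :
    ∫ y in (0 : ℝ)..t, f y = ∑ p ∈ Finset.range q, τ p * phi (p + 2) t +
      lconv (phi (q + 1)) (iteratedDeriv q f) t := by
  induction q with
  | zero => simp [← lconv_phi_one]
  | succ q ih =>
    rw [ih (by omega), Finset.sum_range_succ, lconv_phi_eq_add ht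
      (hf.iteratedDeriv_eq_add_integral (by omega) ht htb).1 (fun s hs =>
        (hf.iteratedDeriv_eq_add_integral (q := q) (by omega) hs.1
          ((EReal.coe_lt_coe_iff.2 hs.2).trans htb)).2), add_assoc]
    congr 4
    push_cast
    ring

theorem continuousOn (hf : IsScalarSolution m n r l A τ b f) {c : ℝ} (hcb : (c : EReal) < b) :
    ContinuousOn f (Ioo 0 c) := by
  simpa using hf.continuousOn_iteratedDeriv hcb (Nat.zero_le _)

theorem intervalIntegrable (hn : 0 < n.re) (hf : IsScalarSolution m n r l A τ b f) {t : ℝ}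
    (ht : 0 < t) (htb : (t : EReal) < b) : IntervalIntegrable f volume 0 t := by
  obtain ⟨c, htc, hcb⟩ := EReal.lt_iff_exists_real_btwn.1 htb
  have h := hf.init 0 (order_pos hn)
  rw [iteratedDeriv_zero] at h
  exact intervalIntegrable_of_continuousOn_of_tendsto ht (EReal.coe_lt_coe_iff.1 htc)
    (hf.continuousOn hcb) h

theorem intervalIntegrable_iteratedDeriv_order (hn : 0 < n.re)
    (hf : IsScalarSolution m n r l A τ b f) {t : ℝ} (ht : 0 < t) (htb : (t : EReal) < b) :
    IntervalIntegrable (iteratedDeriv (order n) f) volume 0 t := by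
  have hpos := order_pos hn
  have h := (hf.iteratedDeriv_eq_add_integral (q := order n - 1) (by omega) ht htb).1
  rwa [Nat.sub_add_cancel hpos] at h

/-- The equation, integrated once.  This form is the same whether or not `Re n` is an integer. -/
theorem lconv_kernel_iteratedDeriv (hm : 0 < m.re) (hn : 0 < n.re)
    (hf : IsScalarSolution m n r l A τ b f) {t : ℝ} (ht : 0 < t) (htb : (t : EReal) < b) :
    lconv (kernel m (order n - n + 1) r (-l)) (iteratedDeriv (order n) f) t =
      A * ∫ y in (0 : ℝ)..t, f y := by
  have hint := hf.intervalIntegrable_iteratedDeriv_order hn ht htb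
  have hlt : ∀ {s : ℝ}, s ≤ t → (s : EReal) < b := fun hs =>
    (EReal.coe_le_coe_iff.2 hs).trans_lt htb
  by_cases h : 0 < ((order n : ℂ) - n).re
  · have h1 := lconv_kernel_lconv_kernel hm (q := 1) (by simp) h
      (by rw [Complex.add_re, Complex.one_re]; linarith) r 0 (-l) ht.le hint
    rw [zero_add, add_comm 1] at h1
    rw [← h1, lconv_congr ht.le (fun s hs => kernel_zero_right m 1 r hs.1) (fun _ _ => rfl),
      lconv_phi_one, ← intervalIntegral.integral_const_mul]
    refine intervalIntegral.integral_congr_ae ?_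
    filter_upwards [hf.eqn] with s hs hst
    rw [uIoc_of_le ht.le] at hst
    have h2 := hs hst.1 (hlt hst.2)
    rw [regDeriv, integral, if_pos h] at h2
    exact h2
  · have hk : ((order n : ℂ) - n).re = 0 := by
      have := re_le_order n
      simp only [Complex.sub_re, Complex.natCast_re] at h ⊢
      linarith
    have hac := hf.mem.2 hk t ht htb
    have h3 := hac.intervalIntegrable_deriv_and_integral_eq.2
    have h4 : conv m (order n - n + 1) r (-l) (iteratedDeriv (order n) f) 0 = 0 := by
      simp [conv]
    rw [h4, sub_zero] at h3
    refine h3.symm.trans ?_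
    rw [← intervalIntegral.integral_const_mul]
    refine intervalIntegral.integral_congr_ae ?_
    filter_upwards [hf.eqn] with s hs hst
    rw [uIoc_of_le ht.le] at hst
    have h2 := hs hst.1 (hlt hst.2)
    rw [regDeriv, integral, if_neg h] at h2
    exact h2

/-- A solution satisfies a Volterra equation with the kernel `e^l_{m,n+1}`: convolve the
integrated equation with the inverse kernel `e^l_{m,n}`. -/
theorem volterra (hm : 0 < m.re) (hn : 0 < n.re) (hf : IsScalarSolution m n r l A τ b f) {t : ℝ}
    (ht : 0 < t) (htb : (t : EReal) < b) :
    ∫ y in (0 : ℝ)..t, f y = ∑ p ∈ Finset.range (order n), τ p * phi (p + 2) t +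
      A * lconv (kernel m (n + 1) r l) f t := by
  have hq : 0 < ((order n : ℂ) - n + 1).re := by
    have := re_le_order n
    simp only [Complex.sub_re, Complex.natCast_re, Complex.add_re, Complex.one_re]
    linarith
  have h1 := lconv_kernel_lconv_kernel hm hn hq (by
    rw [show n + ((order n : ℂ) - n + 1) = order n + 1 by ring]
    simp) r l (-l) ht.le (hf.intervalIntegrable_iteratedDeriv_order hn ht htb)
  rw [add_neg_cancel, show n + ((order n : ℂ) - n + 1) = order n + 1 by ring,
    lconv_congr (g := iteratedDeriv (order n) f) ht.le
      (fun s hs => kernel_zero_right m (order n + 1) r hs.1) (fun _ _ => rfl)] at h1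
  have h2 := lconv_kernel_lconv_kernel hm hn (q' := 1) (by simp) (by
    rw [Complex.add_re, Complex.one_re]; linarith) r l 0 ht.le (hf.intervalIntegrable hn ht htb)
  rw [add_zero] at h2
  rw [hf.integral_eq_taylor le_rfl ht htb, ← h1, ← h2, ← lconv_const_mul_right]
  congr 1
  refine lconv_congr ht.le (fun _ _ => rfl) fun s hs => ?_
  rw [hf.lconv_kernel_iteratedDeriv hm hn hs.1 ((EReal.coe_lt_coe_iff.2 hs.2).trans htb),
    lconv_congr hs.1.le (fun y hy => kernel_zero_right m 1 r hy.1) (fun _ _ => rfl), lconv_phi_one]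

end IsScalarSolution

/-! ### Uniqueness -/

/-- An integrable function that solves the homogeneous Volterra equation has zero primitive: the
iterated kernels `A^j e^{jl}_{m,jn+1}` are the terms of a convergent series, hence tend to `0`
uniformly. -/
theorem integral_eq_zero_of_volterra {m n : ℂ} (hm : 0 < m.re) (hn : 0 < n.re) {r l A : ℂ}
    {D : ℝ → ℂ} {t : ℝ} (ht : 0 < t) (hD : IntervalIntegrable D volume 0 t)
    (h : ∀ s ∈ Ioc 0 t, ∫ y in (0 : ℝ)..s, D y = A * lconv (kernel m (n + 1) r l) D s) :
    ∫ y in (0 : ℝ)..t, D y = 0 := by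
  have hDs : ∀ s ∈ Ioc 0 t, IntervalIntegrable D volume 0 s := fun s hs =>
    hD.mono_set (uIcc_subset_uIcc_left (by rw [uIcc_of_le ht.le]; exact ⟨hs.1.le, hs.2⟩))
  have hre : ∀ j : ℕ, ((1 : ℂ) + j * n).re = 1 + j * n.re := fun j => by simp
  have hiter : ∀ j : ℕ, ∀ s ∈ Ioc 0 t, ∫ y in (0 : ℝ)..s, D y =
      A ^ j * lconv (kernel m (1 + j * n) r (0 + j * l)) D s := by
    intro j
    induction j with
    | zero =>
      intro s hs
      simp only [Nat.cast_zero, zero_mul, add_zero, pow_zero, one_mul]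
      rw [lconv_congr hs.1.le (fun y hy => kernel_zero_right m 1 r hy.1) (fun _ _ => rfl),
        lconv_phi_one]
    | succ j ih =>
      intro s hs
      have hj : 0 ≤ (j : ℝ) * n.re := by positivity
      have h1 := lconv_kernel_lconv_kernel hm hn (q' := 1) (by simp) (by
        rw [Complex.add_re, Complex.one_re]; linarith) r l 0 hs.1.le (hDs s hs)
      have h2 := lconv_kernel_lconv_kernel hm hn (q' := 1 + j * n) (by rw [hre]; linarith) (by
        rw [Complex.add_re, hre]; linarith) r l (0 + j * l) hs.1.le (hDs s hs)
      rw [add_zero] at h1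
      rw [show (1 : ℂ) + (j + 1 : ℕ) * n = n + (1 + j * n) by push_cast; ring,
        show (0 : ℂ) + (j + 1 : ℕ) * l = l + (0 + j * l) by push_cast; ring, ← h2, h s hs, ← h1,
        pow_succ', mul_assoc, ← lconv_const_mul_right (A ^ j)]
      congr 1
      refine lconv_congr hs.1.le (fun _ _ => rfl) fun y hy => ?_
      rw [← ih y ⟨hy.1, hy.2.le.trans hs.2⟩,
        lconv_congr hy.1.le (fun y hy => kernel_zero_right m 1 r hy.1) (fun _ _ => rfl),
        lconv_phi_one]
  obtain ⟨B, hB, hBb⟩ :=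
    (dominatedSeries_kernelSeries hm hn (q := 1) (by simp) r l A 0).bound t
  have hbd : ∀ j, ‖∫ y in (0 : ℝ)..t, D y‖ ≤ B j * ∫ y in (0 : ℝ)..t, ‖D y‖ := by
    intro j
    rw [hiter j t ⟨ht, le_rfl⟩, ← lconv_const_mul_left, lconv,
      ← intervalIntegral.integral_const_mul]
    refine intervalIntegral.norm_integral_le_of_norm_le ht.le ?_ (hD.norm.const_mul _)
    have hne : ∀ᵐ y : ℝ, y ≠ t := by simp [ae_iff]
    filter_upwards [hne] with y hy hyt
    have h3 := hBb j (t - y) ⟨sub_pos.2 (lt_of_le_of_ne hyt.2 hy), by linarith [hyt.1]⟩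
    rw [norm_mul]
    simp only [Complex.one_re, sub_self, Real.rpow_zero, mul_one] at h3
    gcongr
  have hlim := hB.tendsto_atTop_zero.mul_const (∫ y in (0 : ℝ)..t, ‖D y‖)
  rw [zero_mul] at hlim
  exact norm_le_zero_iff.1 (ge_of_tendsto' hlim hbd)

/-- Both solutions satisfy the same inhomogeneous Volterra equation, so their difference satisfies
the homogeneous one. -/
theorem IsScalarSolution.eqOn {m n : ℂ} (hm : 0 < m.re) (hn : 0 < n.re) {r l A : ℂ} {τ : ℕ → ℂ}
    {b : EReal} {f g : ℝ → ℂ} (hf : IsScalarSolution m n r l A τ b f) {b' : EReal}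
    (hg : IsScalarSolution m n r l A τ b' g) (hbb : b ≤ b') {t : ℝ} (ht : 0 < t)
    (htb : (t : EReal) < b) : f t = g t := by
  obtain ⟨c, htc, hcb⟩ := EReal.lt_iff_exists_real_btwn.1 htb
  have htc : t < c := EReal.coe_lt_coe_iff.1 htc
  have hlt : ∀ {s : ℝ}, s < c → (s : EReal) < b := fun hs =>
    (EReal.coe_lt_coe_iff.2 hs).trans hcb
  have hcont : ContinuousOn (fun y => f y - g y) (Ioo 0 c) :=
    (hf.continuousOn hcb).sub (hg.continuousOn (hcb.trans_le hbb))
  have hint : ∀ s ∈ Ioo 0 c, IntervalIntegrable (fun y => f y - g y) volume 0 s := fun s hs =>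
    (hf.intervalIntegrable hn hs.1 (hlt hs.2)).sub
      (hg.intervalIntegrable hn hs.1 ((hlt hs.2).trans_le hbb))
  have hvol : ∀ s ∈ Ioo 0 c, ∫ y in (0 : ℝ)..s, (f y - g y) =
      A * lconv (kernel m (n + 1) r l) (fun y => f y - g y) s := by
    intro s hs
    have if' := hf.intervalIntegrable hn hs.1 (hlt hs.2)
    have ig := hg.intervalIntegrable hn hs.1 ((hlt hs.2).trans_le hbb)
    have hn1 : 1 ≤ (n + 1).re := by rw [Complex.add_re, Complex.one_re]; linarith
    have hk := powerBound_kernel hm (by linarith : 0 < (n + 1).re) r l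
    rw [intervalIntegral.integral_sub if' ig, hf.volterra hm hn hs.1 (hlt hs.2),
      hg.volterra hm hn hs.1 ((hlt hs.2).trans_le hbb),
      lconv_sub (hk.intervalIntegrable_mul_of_one_le hn1 hs.1.le if')
        (hk.intervalIntegrable_mul_of_one_le hn1 hs.1.le ig)]
    ring
  have hzero : ∀ s ∈ Ioo 0 c, ∫ y in (0 : ℝ)..s, (f y - g y) = 0 := fun s hs =>
    integral_eq_zero_of_volterra hm hn hs.1 (hint s hs)
      fun y hy => hvol y ⟨hy.1, hy.2.trans_lt hs.2⟩
  have hmem : t ∈ Ioo 0 c := ⟨ht, htc⟩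
  have hd := intervalIntegral.integral_hasDerivAt_right (hint t hmem)
    (hcont.stronglyMeasurableAtFilter isOpen_Ioo t hmem)
    (hcont.continuousAt (isOpen_Ioo.mem_nhds hmem))
  have hz : HasDerivAt (fun s => ∫ y in (0 : ℝ)..s, (f y - g y)) 0 t := by
    refine (hasDerivAt_const t (0 : ℂ)).congr_of_eventuallyEq ?_
    filter_upwards [isOpen_Ioo.mem_nhds hmem] with s hs using hzero s hs
  exact sub_eq_zero.1 (hd.unique hz)

end Prabhakar

namespace Bicomplex

/-! ### Idempotent components -/

theorem P₁_ofIdem (a b : ℂ) : P₁ (ofIdem a b) = a := by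
  have hI : Complex.I * Complex.I = -1 := Complex.I_mul_I
  simp [ofIdem, P₁, e₁, e₂]
  linear_combination (-(a - b) / 2) * hI

theorem P₂_ofIdem (a b : ℂ) : P₂ (ofIdem a b) = b := by
  have hI : Complex.I * Complex.I = -1 := Complex.I_mul_I
  simp [ofIdem, P₂, e₁, e₂]
  linear_combination ((a - b) / 2) * hI

theorem ext_P {ζ ω : Bicomplex} (h₁ : P₁ ζ = P₁ ω) (h₂ : P₂ ζ = P₂ ω) : ζ = ω := by
  rw [← ofIdem_P ζ, h₁, h₂, ofIdem_P]

/-- The first idempotent component as a ring homomorphism. -/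
def P₁Hom : Bicomplex →+* ℂ where
  toFun := P₁
  map_one' := by simp [P₁, QuadraticAlgebra.re_one, QuadraticAlgebra.im_one]
  map_zero' := by simp [P₁]
  map_add' ζ ω := by simp [P₁]; ring
  map_mul' ζ ω := by
    have hI : Complex.I * Complex.I = -1 := Complex.I_mul_I
    simp [P₁]
    linear_combination (-(ζ.im * ω.im)) * hI

/-- The second idempotent component as a ring homomorphism. -/
def P₂Hom : Bicomplex →+* ℂ where
  toFun := P₂
  map_one' := by simp [P₂, QuadraticAlgebra.re_one, QuadraticAlgebra.im_one]
  map_zero' := by simp [P₂]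
  map_add' ζ ω := by simp [P₂]; ring
  map_mul' ζ ω := by
    have hI : Complex.I * Complex.I = -1 := Complex.I_mul_I
    simp [P₂]
    linear_combination (-(ζ.im * ω.im)) * hI

theorem P₁Hom_apply (ζ : Bicomplex) : P₁Hom ζ = P₁ ζ := rfl

theorem P₂Hom_apply (ζ : Bicomplex) : P₂Hom ζ = P₂ ζ := rfl

theorem P₁_smul (c : ℂ) (ζ : Bicomplex) : P₁ (c • ζ) = c * P₁ ζ := by simp [P₁]; ring

theorem P₂_smul (c : ℂ) (ζ : Bicomplex) : P₂ (c • ζ) = c * P₂ ζ := by simp [P₂]; ring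

theorem re_P₁ (ζ : Bicomplex) : (P₁ ζ).re = rePart ζ + imJ ζ := by simp [P₁, rePart, imJ]

theorem re_P₂ (ζ : Bicomplex) : (P₂ ζ).re = rePart ζ - imJ ζ := by
  simp [P₂, rePart, imJ]; ring

/-! ### Convergence is componentwise -/

theorem isInducing_coords : IsInducing fun ζ : Bicomplex => ((ζ.re, ζ.im) : ℂ × ℂ) := ⟨rfl⟩

instance : T2Space Bicomplex :=
  T2Space.of_injective_continuous (f := fun ζ : Bicomplex => ((ζ.re, ζ.im) : ℂ × ℂ))
    (fun ζ ω h => by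
      simp only [Prod.mk.injEq] at h
      exact QuadraticAlgebra.ext h.1 h.2) isInducing_coords.continuous

theorem hasSum_of_P {ι : Type*} {f : ι → Bicomplex} {a b : ℂ} (h₁ : HasSum (fun i => P₁ (f i)) a)
    (h₂ : HasSum (fun i => P₂ (f i)) b) : HasSum f (ofIdem a b) := by
  let coords : Bicomplex →+ ℂ × ℂ :=
    { toFun := fun ζ => (ζ.re, ζ.im)
      map_zero' := rfl
      map_add' := fun _ _ => rfl }
  have hcoords : IsInducing coords := isInducing_coords
  rw [← hcoords.hasSum_iff]
  refine HasSum.prodMk ?_ ?_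
  · have h := (h₁.add h₂).mul_left (1 / 2 : ℂ)
    have e : (1 / 2 : ℂ) * (a + b) = (ofIdem a b).re := by simp [ofIdem, e₁, e₂]; ring
    rw [e] at h
    refine h.congr_fun fun i => ?_
    simp [P₁, P₂]
    ring
  · have h := (h₁.sub h₂).mul_left (Complex.I / 2)
    have e : (Complex.I / 2) * (a - b) = (ofIdem a b).im := by simp [ofIdem, e₁, e₂]; ring
    rw [e] at h
    refine h.congr_fun fun i => ?_
    have hI : Complex.I * Complex.I = -1 := Complex.I_mul_I
    simp [P₁, P₂]
    linear_combination (f i).im * hI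

theorem tsum_eq_ofIdem {ι : Type*} {f : ι → Bicomplex} (h₁ : Summable fun i => P₁ (f i))
    (h₂ : Summable fun i => P₂ (f i)) :
    ∑' i, f i = ofIdem (∑' i, P₁ (f i)) (∑' i, P₂ (f i)) :=
  (hasSum_of_P h₁.hasSum h₂.hasSum).tsum_eq

/-! ### Components of the Prabhakar function and of the Cauchy series -/

/-- The general term of the complex Prabhakar series at `ζ = r t ^ m` is summable. -/
theorem summable_prabhakar_term {m n : ℂ} (hm : 0 < m.re) (hn : 0 < n.re) (r l : ℂ) {t : ℝ}
    (ht : 0 < t) :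
    Summable fun u : ℕ => (ascPochhammer ℂ u).eval l / ((u ! : ℂ) * Complex.Gamma (m * u + n)) *
      (r * (t : ℂ) ^ m) ^ u := by
  have ht' : (t : ℂ) ≠ 0 := Complex.ofReal_ne_zero.2 ht.ne'
  have h := ((Prabhakar.dominatedSeries_kernel hm hn r l).summable ht).mul_left
    ((t : ℂ) ^ (n - 1))⁻¹
  refine h.congr fun u => ?_
  have hne : (t : ℂ) ^ (n - 1) ≠ 0 := by simp [Complex.cpow_eq_zero_iff, ht']
  rw [Prabhakar.phi, Prabhakar.coef, add_sub_right_comm, Complex.cpow_add _ _ ht',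
    Complex.cpow_nat_mul, mul_pow, mul_comm m, add_comm n]
  simp only [div_eq_mul_inv, mul_inv]
  field_simp

theorem P₁_prabhakar_term (m n l ζ : Bicomplex) (u : ℕ) :
    P₁ (((u ! : ℂ)⁻¹) •
      ((ascPochhammer Bicomplex u).eval l * recipGamma (m * (u : Bicomplex) + n) * ζ ^ u)) =
    (ascPochhammer ℂ u).eval (P₁ l) / ((u ! : ℂ) * Complex.Gamma (P₁ m * u + P₁ n)) *
      P₁ ζ ^ u := by
  have h1 : P₁Hom ((ascPochhammer Bicomplex u).eval l) = (ascPochhammer ℂ u).eval (P₁ l) := by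
    rw [← Polynomial.eval₂_hom, ← Polynomial.eval_map, ascPochhammer_map]
    rfl
  rw [P₁_smul, ← P₁Hom_apply, map_mul, map_mul, map_pow, h1, P₁Hom_apply, recipGamma, P₁_ofIdem,
    ← P₁Hom_apply (_ + _), map_add, map_mul, map_natCast]
  simp only [P₁Hom_apply, div_eq_mul_inv, mul_inv]
  ring

theorem P₂_prabhakar_term (m n l ζ : Bicomplex) (u : ℕ) :
    P₂ (((u ! : ℂ)⁻¹) •
      ((ascPochhammer Bicomplex u).eval l * recipGamma (m * (u : Bicomplex) + n) * ζ ^ u)) =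
    (ascPochhammer ℂ u).eval (P₂ l) / ((u ! : ℂ) * Complex.Gamma (P₂ m * u + P₂ n)) *
      P₂ ζ ^ u := by
  have h1 : P₂Hom ((ascPochhammer Bicomplex u).eval l) = (ascPochhammer ℂ u).eval (P₂ l) := by
    rw [← Polynomial.eval₂_hom, ← Polynomial.eval_map, ascPochhammer_map]
    rfl
  rw [P₂_smul, ← P₂Hom_apply, map_mul, map_mul, map_pow, h1, P₂Hom_apply, recipGamma, P₂_ofIdem,
    ← P₂Hom_apply (_ + _), map_add, map_mul, map_natCast]
  simp only [P₂Hom_apply, div_eq_mul_inv, mul_inv]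
  ring

theorem prabhakar_eq_ofIdem {m n : Bicomplex} (hm₁ : 0 < (P₁ m).re) (hm₂ : 0 < (P₂ m).re)
    (hn₁ : 0 < (P₁ n).re) (hn₂ : 0 < (P₂ n).re) (r l : Bicomplex) {t : ℝ} (ht : 0 < t) :
    prabhakar m n l (r * rpow t m) =
      ofIdem (Prabhakar.fn (P₁ m) (P₁ n) (P₁ l) (P₁ r * (t : ℂ) ^ P₁ m))
        (Prabhakar.fn (P₂ m) (P₂ n) (P₂ l) (P₂ r * (t : ℂ) ^ P₂ m)) := by
  have hζ₁ : P₁ (r * rpow t m) = P₁ r * (t : ℂ) ^ P₁ m := by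
    rw [← P₁Hom_apply, map_mul, P₁Hom_apply, P₁Hom_apply, rpow, P₁_ofIdem]
  have hζ₂ : P₂ (r * rpow t m) = P₂ r * (t : ℂ) ^ P₂ m := by
    rw [← P₂Hom_apply, map_mul, P₂Hom_apply, P₂Hom_apply, rpow, P₂_ofIdem]
  unfold prabhakar Prabhakar.fn
  rw [tsum_eq_ofIdem]
  · simp only [P₁_prabhakar_term, P₂_prabhakar_term, hζ₁, hζ₂]
  · simp only [P₁_prabhakar_term, hζ₁]
    exact summable_prabhakar_term hm₁ hn₁ _ _ ht
  · simp only [P₂_prabhakar_term, hζ₂]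
    exact summable_prabhakar_term hm₂ hn₂ _ _ ht

section Series

variable {m n : Bicomplex} (hm₁ : 0 < (P₁ m).re) (hm₂ : 0 < (P₂ m).re) (hn₁ : 0 < (P₁ n).re)
  (hn₂ : 0 < (P₂ n).re) (r l A : Bicomplex)
include hm₁ hm₂ hn₁ hn₂

theorem cauchyTerm_eq_ofIdem (p j : ℕ) {t : ℝ} (ht : 0 < t) :
    cauchyTerm m n r l A p j t = ofIdem
      (P₁ A ^ j * Prabhakar.kernel (P₁ m) (p + 1 + j * P₁ n) (P₁ r) (0 + j * P₁ l) t)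
      (P₂ A ^ j * Prabhakar.kernel (P₂ m) (p + 1 + j * P₂ n) (P₂ r) (0 + j * P₂ l) t) := by
  have h₁ : P₁ (n * (j : Bicomplex) + (p : Bicomplex) + 1) = p + 1 + j * P₁ n := by
    rw [← P₁Hom_apply, map_add, map_add, map_mul, map_natCast, map_natCast, map_one, P₁Hom_apply]
    ring
  have h₂ : P₂ (n * (j : Bicomplex) + (p : Bicomplex) + 1) = p + 1 + j * P₂ n := by
    rw [← P₂Hom_apply, map_add, map_add, map_mul, map_natCast, map_natCast, map_one, P₂Hom_apply]
    ring
  have h₁' : P₁ (n * (j : Bicomplex) + (p : Bicomplex)) = p + 1 + j * P₁ n - 1 := by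
    rw [← h₁, ← P₁Hom_apply, ← P₁Hom_apply, map_add _ _ 1, map_one]
    ring
  have h₂' : P₂ (n * (j : Bicomplex) + (p : Bicomplex)) = p + 1 + j * P₂ n - 1 := by
    rw [← h₂, ← P₂Hom_apply, ← P₂Hom_apply, map_add _ _ 1, map_one]
    ring
  have hl₁ : P₁ ((j : Bicomplex) * l) = 0 + j * P₁ l := by
    rw [← P₁Hom_apply, map_mul, map_natCast, zero_add, P₁Hom_apply]
  have hl₂ : P₂ ((j : Bicomplex) * l) = 0 + j * P₂ l := by
    rw [← P₂Hom_apply, map_mul, map_natCast, zero_add, P₂Hom_apply]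
  have hpos : ∀ {z : ℂ}, 0 < z.re → 0 < ((p : ℂ) + 1 + j * z).re := by
    intro z hz
    have : ((p : ℂ) + 1 + j * z).re = p + 1 + j * z.re := by simp
    rw [this]
    positivity
  have hE := prabhakar_eq_ofIdem (n := n * (j : Bicomplex) + (p : Bicomplex) + 1) hm₁ hm₂
    (by rw [h₁]; exact hpos hn₁) (by rw [h₂]; exact hpos hn₂) r ((j : Bicomplex) * l) ht
  rw [h₁, h₂, hl₁, hl₂] at hE
  rw [cauchyTerm, hE, rpow, h₁', h₂']
  refine ext_P ?_ ?_
  · rw [P₁_ofIdem, ← P₁Hom_apply, map_mul, map_mul, map_pow]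
    simp only [P₁Hom_apply, P₁_ofIdem, Prabhakar.kernel]
    ring
  · rw [P₂_ofIdem, ← P₂Hom_apply, map_mul, map_mul, map_pow]
    simp only [P₂Hom_apply, P₂_ofIdem, Prabhakar.kernel]
    ring

theorem hasSum_cauchyTerm (p : ℕ) {t : ℝ} (ht : 0 < t) :
    HasSum (fun j => cauchyTerm m n r l A p j t) (ofIdem
      (Prabhakar.kernelSeries (P₁ m) (P₁ n) (P₁ r) (P₁ l) (P₁ A) (p + 1) 0 t)
      (Prabhakar.kernelSeries (P₂ m) (P₂ n) (P₂ r) (P₂ l) (P₂ A) (p + 1) 0 t)) := by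
  have hp : 0 < ((p : ℂ) + 1).re := by
    simp only [Complex.add_re, Complex.natCast_re, Complex.one_re]; positivity
  refine hasSum_of_P ?_ ?_
  · simp only [cauchyTerm_eq_ofIdem hm₁ hm₂ hn₁ hn₂ r l A p _ ht, P₁_ofIdem]
    exact ((Prabhakar.dominatedSeries_kernelSeries hm₁ hn₁ hp _ _ _ 0).summable ht).hasSum
  · simp only [cauchyTerm_eq_ofIdem hm₁ hm₂ hn₁ hn₂ r l A p _ ht, P₂_ofIdem]
    exact ((Prabhakar.dominatedSeries_kernelSeries hm₂ hn₂ hp _ _ _ 0).summable ht).hasSum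

theorem cauchySeries_eq_ofIdem (τ : ℕ → Bicomplex) {t : ℝ} (ht : 0 < t) :
    cauchySeries m n r l A τ t = ofIdem
      (Prabhakar.sol (P₁ m) (P₁ n) (P₁ r) (P₁ l) (P₁ A) (fun p => P₁ (τ p)) t)
      (Prabhakar.sol (P₂ m) (P₂ n) (P₂ r) (P₂ l) (P₂ A) (fun p => P₂ (τ p)) t) := by
  have he₁ : e₁ = ofIdem 1 0 := by simp [ofIdem]
  have he₂ : e₂ = ofIdem 0 1 := by simp [ofIdem]
  unfold cauchySeries Prabhakar.sol
  simp only [(hasSum_cauchyTerm hm₁ hm₂ hn₁ hn₂ r l A _ ht).tsum_eq]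
  refine ext_P ?_ ?_
  · rw [P₁_ofIdem, ← P₁Hom_apply, map_add, map_mul, map_mul, map_sum, he₁, he₂]
    simp only [map_mul, P₁Hom_apply, P₁_ofIdem]
    ring
  · rw [P₂_ofIdem, ← P₂Hom_apply, map_add, map_mul, map_mul, map_sum, map_sum, he₁, he₂]
    simp only [map_mul, P₂Hom_apply, P₂_ofIdem]
    ring

end Series

/-! ### From components to bicomplex solutions -/

theorem isCauchySolution_iff {m n r l A : Bicomplex} {τ : ℕ → Bicomplex} {b : EReal}
    {f : ℝ → Bicomplex} :
    IsCauchySolution m n r l A τ b f ↔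
      Prabhakar.IsScalarSolution (P₁ m) (P₁ n) (P₁ r) (P₁ l) (P₁ A) (fun p => P₁ (τ p)) b
        (fun t => P₁ (f t)) ∧
      Prabhakar.IsScalarSolution (P₂ m) (P₂ n) (P₂ r) (P₂ l) (P₂ A) (fun p => P₂ (τ p)) b
        (fun t => P₂ (f t)) := by
  constructor
  · intro h
    refine ⟨⟨h.mem₁, h.init₁, ?_⟩, ⟨h.mem₂, h.init₂, ?_⟩⟩
    · filter_upwards [h.eqn] with t ht h0 hb
      have := congrArg P₁Hom (ht h0 hb)
      rwa [map_mul, P₁Hom_apply, P₁Hom_apply, P₁Hom_apply, regDeriv, P₁_ofIdem] at this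
    · filter_upwards [h.eqn] with t ht h0 hb
      have := congrArg P₂Hom (ht h0 hb)
      rwa [map_mul, P₂Hom_apply, P₂Hom_apply, P₂Hom_apply, regDeriv, P₂_ofIdem] at this
  · rintro ⟨h₁, h₂⟩
    refine ⟨h₁.mem, h₂.mem, h₁.init, h₂.init, ?_⟩
    filter_upwards [h₁.eqn, h₂.eqn] with t ht₁ ht₂ h0 hb
    refine ext_P ?_ ?_
    · rw [regDeriv, P₁_ofIdem, ht₁ h0 hb, ← P₁Hom_apply (A * f t), map_mul]
      rfl
    · rw [regDeriv, P₂_ofIdem, ht₂ h0 hb, ← P₂Hom_apply (A * f t), map_mul]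
      rfl

end Bicomplex

namespace Prabhakar

/-! ### The Cauchy problem only sees the half-line `t > 0` -/

theorem eqOn_iteratedDeriv {f g : ℝ → ℂ} (h : EqOn f g (Ioi 0)) (i : ℕ) :
    EqOn (iteratedDeriv i f) (iteratedDeriv i g) (Ioi 0) := by
  intro t ht
  refine Filter.EventuallyEq.iteratedDeriv_eq i ?_
  filter_upwards [isOpen_Ioi.mem_nhds ht] with s hs using h hs

theorem conv_congr {m n r l : ℂ} {f g : ℝ → ℂ} (h : EqOn f g (Ioi 0)) {t : ℝ} (ht : 0 ≤ t) :
    conv m n r l f t = conv m n r l g t :=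
  lconv_congr (a := kernel m n r l) ht (fun _ _ => rfl) fun _ hs => h hs.1

theorem regDeriv_congr {m n r l : ℂ} {f g : ℝ → ℂ} (h : EqOn f g (Ioi 0)) {t : ℝ} (ht : 0 < t) :
    regDeriv m n r l f t = regDeriv m n r l g t := by
  have h1 := eqOn_iteratedDeriv h (order n)
  unfold regDeriv integral
  split_ifs
  · exact conv_congr h1 ht.le
  · refine Filter.EventuallyEq.deriv_eq ?_
    filter_upwards [isOpen_Ioi.mem_nhds ht] with s hs using conv_congr h1 (le_of_lt hs)

theorem IsScalarSolution.congr {m n r l A : ℂ} {τ : ℕ → ℂ} {b : EReal} {f g : ℝ → ℂ}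
    (hf : IsScalarSolution m n r l A τ b f) (h : EqOn g f (Ioi 0)) :
    IsScalarSolution m n r l A τ b g := by
  refine ⟨⟨⟨hf.mem.1.1.congr fun t ht => h ht.1, fun c hc hcb => ?_⟩, fun hk c hc hcb => ?_⟩,
    fun p hp => ?_, ?_⟩
  · obtain ⟨H, hac, heq⟩ := hf.mem.1.2 c hc hcb
    exact ⟨H, hac, fun t ht => (eqOn_iteratedDeriv h _ ht.1).trans (heq ht)⟩
  · refine (hf.mem.2 hk c hc hcb).congr fun t ht => ?_
    rw [uIcc_of_le hc.le] at ht
    exact conv_congr (eqOn_iteratedDeriv h _) ht.1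
  · refine (hf.init p hp).congr' ?_
    filter_upwards [self_mem_nhdsWithin] with t ht using (eqOn_iteratedDeriv h p ht).symm
  · filter_upwards [hf.eqn] with t ht h0 hb
    rw [regDeriv_congr h h0, ht h0 hb, h h0]

end Prabhakar

theorem mainTheorem2 (m n r l A : Bicomplex) (τ : ℕ → Bicomplex)
    (hm : |Bicomplex.imJ m| < Bicomplex.rePart m)
    (hn : |Bicomplex.imJ n| < Bicomplex.rePart n) :
    -- the series in `j` converges
    (∀ (p : ℕ) (t : ℝ), 0 < t →
      Summable (fun j : ℕ => Bicomplex.cauchyTerm m n r l A p j t)) ∧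
    -- the double series solves the Cauchy problem on `(0, ∞)`, the equation at every `t > 0`
    (Bicomplex.IsCauchySolution m n r l A τ ⊤ (Bicomplex.cauchySeries m n r l A τ) ∧
      ∀ t : ℝ, 0 < t →
        Bicomplex.regDeriv m n r l (Bicomplex.cauchySeries m n r l A τ) t =
          A * Bicomplex.cauchySeries m n r l A τ t) ∧
    -- every solution on an interval `(0, b)`, `0 < b ≤ ∞`, is given there by the double series
    (∀ (b : EReal) (f : ℝ → Bicomplex), 0 < b →
      Bicomplex.IsCauchySolution m n r l A τ b f →
        ∀ t : ℝ, 0 < t → (t : EReal) < b →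
          f t = Bicomplex.cauchySeries m n r l A τ t) := by
  have hm₁ : 0 < (Bicomplex.P₁ m).re := by
    rw [Bicomplex.re_P₁]; linarith [(abs_lt.1 hm).1]
  have hm₂ : 0 < (Bicomplex.P₂ m).re := by
    rw [Bicomplex.re_P₂]; linarith [(abs_lt.1 hm).2]
  have hn₁ : 0 < (Bicomplex.P₁ n).re := by
    rw [Bicomplex.re_P₁]; linarith [(abs_lt.1 hn).1]
  have hn₂ : 0 < (Bicomplex.P₂ n).re := by
    rw [Bicomplex.re_P₂]; linarith [(abs_lt.1 hn).2]
  have hF := fun {t : ℝ} (ht : 0 < t) =>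
    Bicomplex.cauchySeries_eq_ofIdem hm₁ hm₂ hn₁ hn₂ r l A τ ht
  have hF₁ : EqOn (fun t => Bicomplex.P₁ (Bicomplex.cauchySeries m n r l A τ t)) _ (Ioi 0) :=
    fun t ht => (congrArg Bicomplex.P₁ (hF ht)).trans (Bicomplex.P₁_ofIdem _ _)
  have hF₂ : EqOn (fun t => Bicomplex.P₂ (Bicomplex.cauchySeries m n r l A τ t)) _ (Ioi 0) :=
    fun t ht => (congrArg Bicomplex.P₂ (hF ht)).trans (Bicomplex.P₂_ofIdem _ _)
  have hsol : Bicomplex.IsCauchySolution m n r l A τ ⊤ (Bicomplex.cauchySeries m n r l A τ) :=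
    Bicomplex.isCauchySolution_iff.2
      ⟨(Prabhakar.isScalarSolution_sol hm₁ hn₁ _ _ _ _).congr hF₁,
        (Prabhakar.isScalarSolution_sol hm₂ hn₂ _ _ _ _).congr hF₂⟩
  refine ⟨fun p t ht =>
    (Bicomplex.hasSum_cauchyTerm hm₁ hm₂ hn₁ hn₂ r l A p ht).summable,
    ⟨hsol, fun t ht => ?_⟩, fun b f _ hf t ht htb => ?_⟩
  · refine Bicomplex.ext_P ?_ ?_
    · rw [Bicomplex.regDeriv, Bicomplex.P₁_ofIdem, Prabhakar.regDeriv_congr hF₁ ht,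
        Prabhakar.regDeriv_sol hm₁ hn₁ _ _ _ _ ht, ← hF₁ ht]
      exact (map_mul Bicomplex.P₁Hom _ _).symm
    · rw [Bicomplex.regDeriv, Bicomplex.P₂_ofIdem, Prabhakar.regDeriv_congr hF₂ ht,
        Prabhakar.regDeriv_sol hm₂ hn₂ _ _ _ _ ht, ← hF₂ ht]
      exact (map_mul Bicomplex.P₂Hom _ _).symm
  · obtain ⟨hf₁, hf₂⟩ := Bicomplex.isCauchySolution_iff.1 hf
    obtain ⟨hs₁, hs₂⟩ := Bicomplex.isCauchySolution_iff.1 hsol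
    exact Bicomplex.ext_P (hf₁.eqOn hm₁ hn₁ hs₁ le_top ht htb)
      (hf₂.eqOn hm₂ hn₂ hs₂ le_top ht htb)
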